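/- Let $R$ be a commutative Noetherian local ring of Krull dimension $d=1$ which is a hypersurface, i.e. its completion $\hat R$ is isomorphic to $T/(f)$ for a regular local ring $T$ and an element $f$ of the maximal ideal of $T$, and which has isolated singularity, i.e. $R_p$ is regular for every non-maximal prime $p$ of $R$. Then for all finitely generated $R$-modules $M,N$ Hochster's function $$\theta^R(M,N)=\ell\big(\operatorname{Tor}^R_{2e+2}(M,N)\big)-\ell\big(\operatorname{Tor}^R_{2e+1}(M,N)\big),\qquad e\ge (d+2)/2,$$ is well defined (both lengths are finite, and the difference does not depend on the integer $e\ge (d+2)/2$). Moreover, for every finitely generated $R$-module $M$ the following are equivalent: 1. $\theta^R(M,N)=0$ for all finitely generated $R$-modules $N$; 2. $M$ has constant rank, i.e. there is an integer $r\ge 0$ with $M_p\cong R_p^{\,r}$ for every associated prime $p$ of $R$; 3. $[M]=0$ in $\overline G(R)_{\mathbb Q}=\overline G(R)\otimes_{\mathbb Z}\mathbb Q$, where $\overline G(R)=G(R)/\mathbb Z[R]$ and $G(R)$ is the Grothendieck group of finitely generated $R$-modules (the abelian group generated by the classes $[M]$ with the relations $[M_2]=[M_1]+[M_3]$ for all short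 exact sequences $0\to M_1\to M_2\to M_3\to 0$). -/

import Mathlib

universe u

open CategoryTheory TensorProduct

noncomputable section

/-- A local ring `R` is a hypersurface if its completion is of the form `T / (f)` with `T` a
regular local ring and `f` in the maximal ideal of `T`. -/
def IsHypersurface (R : Type u) [CommRing R] [IsLocalRing R] : Prop :=
  ∃ (T : Type u) (_ : CommRing T) (_ : IsRegularLocalRing T) (f : T),
    f ∈ IsLocalRing.maximalIdeal T ∧
      Nonempty (AdicCompletion (IsLocalRing.maximalIdeal R) R ≃+* T ⧸ Ideal.span {f})

/-- `R` has (at most) an isolated singularity: `R_p` is regular for every non-maximal prime. -/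
def HasIsolatedSingularity (R : Type u) [CommRing R] [IsLocalRing R] : Prop :=
  ∀ (p : Ideal R) [p.IsPrime], p ≠ IsLocalRing.maximalIdeal R →
    IsRegularLocalRing (Localization.AtPrime p)

/-- The length of `Tor_n^R(M, N)`. -/
def torLength (R : Type u) [CommRing R] (M N : Type u) [AddCommGroup M] [Module R M]
    [AddCommGroup N] [Module R N] (n : ℕ) : ℕ∞ :=
  Module.length R (((Tor (ModuleCat.{u} R) n).obj (ModuleCat.of R M)).obj (ModuleCat.of R N))

/-- `l(Tor_{2e+2}^R(M, N)) - l(Tor_{2e+1}^R(M, N))`, meaningful if both lengths are finite. -/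
def hochsterThetaAt (R : Type u) [CommRing R] (M N : Type u) [AddCommGroup M] [Module R M]
    [AddCommGroup N] [Module R N] (e : ℕ) : ℤ :=
  ((torLength R M N (2 * e + 2)).toNat : ℤ) - ((torLength R M N (2 * e + 1)).toNat : ℤ)

/-- The Krull dimension as a natural number (for rings of finite dimension). -/
def krullDimNat (R : Type u) [CommRing R] : ℕ := ((ringKrullDim R).unbotD 0).toNat

/-- Hochster's function `θ^R(M, N) = l(Tor_{2e+2}^R(M, N)) - l(Tor_{2e+1}^R(M, N))`, computed
with `e = d + 1`, where `d = dim R`; this is one of the integers `e ≥ (d + 2) / 2`.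
That every such `e` gives the same value is `HochsterThetaDefined`. -/
def hochsterTheta (R : Type u) [CommRing R] (M N : Type u) [AddCommGroup M] [Module R M]
    [AddCommGroup N] [Module R N] : ℤ :=
  hochsterThetaAt R M N (krullDimNat R + 1)

/-- `θ^R(M, N)` is well defined: for every integer `e ≥ (d + 2) / 2` the two lengths are finite,
and their difference does not depend on `e`. -/
def HochsterThetaDefined (R : Type u) [CommRing R] (M N : Type u) [AddCommGroup M] [Module R M]
    [AddCommGroup N] [Module R N] : Prop :=
  ∀ e : ℕ, krullDimNat R + 2 ≤ 2 * e →
    torLength R M N (2 * e + 2) ≠ ⊤ ∧ torLength R M N (2 * e + 1) ≠ ⊤ ∧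
      hochsterThetaAt R M N e = hochsterTheta R M N

/-- `M` has constant rank: there is an `r` with `M_p ≅ R_p ^ r` for all associated primes `p`
of `R`. -/
def HasConstantRank (R : Type u) [CommRing R] (M : Type u) [AddCommGroup M] [Module R M] : Prop :=
  ∃ r : ℕ, ∀ (p : Ideal R) [p.IsPrime], p ∈ associatedPrimes R R →
    Nonempty (LocalizedModule p.primeCompl M ≃ₗ[Localization.AtPrime p]
      (Fin r → Localization.AtPrime p))

/-- The relations `[M₂] - [M₁] - [M₃]`, for all short exact sequences
`0 → M₁ → M₂ → M₃ → 0` of finitely generated modules. -/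
def shortExactRelations (R : Type u) [CommRing R] :
    AddSubgroup (FreeAbelianGroup (FGModuleCat.{u} R)) :=
  AddSubgroup.closure
    {x | ∃ (M₁ M₂ M₃ : FGModuleCat.{u} R) (f : M₁ →ₗ[R] M₂) (g : M₂ →ₗ[R] M₃),
      Function.Injective f ∧ Function.Exact f g ∧ Function.Surjective g ∧
        x = FreeAbelianGroup.of M₂ - FreeAbelianGroup.of M₁ - FreeAbelianGroup.of M₃}

/-- `G(R)`, the Grothendieck group of finitely generated `R`-modules. -/
abbrev ModuleGrothendieckGroup (R : Type u) [CommRing R] : Type (u + 1) :=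
  FreeAbelianGroup (FGModuleCat.{u} R) ⧸ shortExactRelations R

/-- The class `[M]` in `G(R)`. -/
def moduleClass (R : Type u) [CommRing R] (M : Type u) [AddCommGroup M] [Module R M]
    [Module.Finite R M] : ModuleGrothendieckGroup R :=
  QuotientAddGroup.mk (FreeAbelianGroup.of (FGModuleCat.of R M))

/-- The reduced Grothendieck group `G(R) / ℤ [R]`. -/
abbrev ReducedGrothendieckGroup (R : Type u) [CommRing R] : Type (u + 1) :=
  ModuleGrothendieckGroup R ⧸ AddSubgroup.zmultiples (moduleClass R R)

/-- The class `[M]` in the reduced Grothendieck group. -/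
def reducedClass (R : Type u) [CommRing R] (M : Type u) [AddCommGroup M] [Module R M]
    [Module.Finite R M] : ReducedGrothendieckGroup R :=
  QuotientAddGroup.mk (moduleClass R M)

/-- The class `1 ⊗ [M]` in `ℚ ⊗ (G(R) / ℤ [R])`. -/
def reducedClassRat (R : Type u) [CommRing R] (M : Type u) [AddCommGroup M] [Module R M]
    [Module.Finite R M] : ℚ ⊗[ℤ] ReducedGrothendieckGroup R :=
  (1 : ℚ) ⊗ₜ[ℤ] reducedClass R M

end

/-! Call a module torsion-free if a fixed regular element x of the maximal ideal acts injectively on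
it. The completion of R is B = T/(f) with dim T ≤ 2. Suppose T has maximal ideal (u, v) and
dimension two. If N is torsion-free, then B ⊗ N has positive depth over T, so the kernel of a free
cover T^n → B ⊗ N is T-free (`free_of_depth_two`). Multiplication by f on T^n factors through this
kernel, and the resulting matrix factorization makes B ⊗ N its own second syzygy over B up to free
summands (`exists_periodic_presentation`). Schanuel's lemma and descent along R → B carry this to R.
Hence Tor_i(M, N) has 2-periodic length for i ≥ 2, and for i ≥ 3 when N is arbitrary, since its
first syzygy is torsion-free. The same freeness argument makes every ideal with torsion-free
quotient principal. If T is not two-dimensional, R is a discrete valuation ring and torsion-free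
modules are free.

At a non-maximal prime R_p is regular of dimension zero, hence a field, so the higher Tor modules
have finite length and θ is well defined. In the long exact sequence additivity fails by ranks of
connecting maps; these are bounded, and periodicity makes them cancel in θ
(`alternating_additive_of_periodic`). Since θ(R, -) = 0, each θ(-, N) factors through the reduced
Grothendieck group: 3 implies 1.

Dévissage gives [M] = Σ rank_p(M) [R/p] over the non-maximal primes, rationally; the residue field
drops out because R/(x) has class zero. With constant rank r the sum is r[R] = 0: 2 implies 3.

For 1 implies 2, each non-maximal prime is q = (a) with Ann(a) = (b) and Ann(b) = (a)
(`exists_mutual_annihilators`). So R/q has a periodic resolution, from which θ(R/p, R/q) > 0 for p ≠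
q. The sum over p of θ(R/p, R/q) is θ(R, R/q) = 0, so this matrix behaves like the Laplacian of a
complete graph: it kills only constant vectors, and θ(M, -) = 0 forces rank_p(M) to be independent
of p. -/

section Splice

/-! ### Resolutions and dimension shifting for Tor -/

variable {C : Type*} [Category* C] [Abelian C]

/-- An exact augmented complex of projectives is a projective resolution. -/
noncomputable def CategoryTheory.ProjectiveResolution.ofExact {Z : C} (K : ChainComplex C ℕ)
    (hK : ∀ n, Projective (K.X n)) (p : K.X 0 ⟶ Z) (w : K.d 1 0 ≫ p = 0) (hp : Epi p)
    (h₀ : (ShortComplex.mk (K.d 1 0) p w).Exact) (hs : ∀ n, K.ExactAt (n + 1)) :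
    ProjectiveResolution Z where
  complex := K
  projective := hK
  π := (ChainComplex.toSingle₀Equiv _ _).symm ⟨p, w⟩
  quasiIso := ⟨fun n => by
    cases n with
    | zero =>
      rw [ChainComplex.quasiIsoAt₀_iff, ShortComplex.quasiIso_iff_of_zeros']
      · refine (ShortComplex.exact_and_epi_g_iff_of_iso (S₂ := ShortComplex.mk (K.d 1 0) p w)
          ?_).2 ⟨h₀, hp⟩
        refine ShortComplex.isoMk (Iso.refl _) (Iso.refl _) (Iso.refl _) ?_ ?_
        · exact (Category.id_comp _).trans (Category.comp_id _).symm
        · refine (Category.id_comp _).trans (Eq.trans ?_ (Category.comp_id _).symm)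
          exact (ChainComplex.toSingle₀Equiv_symm_apply_f_zero p w).symm
      · exact K.shape _ _ (by simp)
      all_goals rfl
    | succ n =>
      rw [quasiIsoAt_iff_exactAt']
      · exact hs n
      · exact ChainComplex.exactAt_succ_single_obj _ _⟩

/-- The augmentation of a projective resolution. -/
noncomputable def CategoryTheory.ProjectiveResolution.aug {Z : C} (Q : ProjectiveResolution Z) :
    Q.complex.X 0 ⟶ Z := Q.π.f 0

lemma CategoryTheory.ProjectiveResolution.d_aug {Z : C} (Q : ProjectiveResolution Z) :
    Q.complex.d 1 0 ≫ Q.aug = 0 := Q.complex_d_comp_π_f_zero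

instance CategoryTheory.ProjectiveResolution.epi_aug {Z : C} (Q : ProjectiveResolution Z) :
    Epi Q.aug := inferInstanceAs (Epi (Q.π.f 0))

lemma CategoryTheory.ProjectiveResolution.exact_aug {Z : C} (Q : ProjectiveResolution Z) :
    (ShortComplex.mk (Q.complex.d 1 0) Q.aug Q.d_aug).Exact := Q.exact₀

/-- The projective resolution of `S.X₃` obtained by splicing a short exact sequence with projective
middle term with a projective resolution of `S.X₁`. -/
noncomputable def CategoryTheory.ProjectiveResolution.splice {S : ShortComplex C}
    (hS : S.ShortExact) [Projective S.X₂] (Q : ProjectiveResolution S.X₁) :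
    ProjectiveResolution S.X₃ :=
  have hf := hS.mono_f
  .ofExact (ChainComplex.augment Q.complex (Q.aug ≫ S.f) (by
      rw [← Category.assoc, Q.d_aug, Limits.zero_comp]))
    (fun n => by
      cases n with
      | zero => assumption
      | succ n => exact Q.projective n)
    S.g
    (by
      rw [ChainComplex.augment_d_one_zero]
      have : (Q.aug ≫ S.f) ≫ S.g = 0 := by rw [Category.assoc, S.zero, Limits.comp_zero]
      exact this) hS.epi_g
    (by
      refine (ShortComplex.exact_iff_of_epi_of_isIso_of_mono
        (S₁ := ShortComplex.mk (Q.aug ≫ S.f) S.g (by rw [Category.assoc, S.zero, Limits.comp_zero]))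
        (S₂ := S) { τ₁ := Q.aug, τ₂ := 𝟙 _, τ₃ := 𝟙 _ }).2 hS.exact)
    (fun n => by
      cases n with
      | zero =>
        rw [HomologicalComplex.exactAt_iff' _ 2 1 0 (by simp) (by simp)]
        exact (ShortComplex.exact_iff_of_epi_of_isIso_of_mono
          (S₁ := ShortComplex.mk (Q.complex.d 1 0) Q.aug Q.d_aug)
          (S₂ := ShortComplex.mk (Q.complex.d 1 0) (Q.aug ≫ S.f) (by
            rw [← Category.assoc, Q.d_aug, Limits.zero_comp]))
          { τ₁ := 𝟙 _, τ₂ := 𝟙 _, τ₃ := S.f }).1 Q.exact_aug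
      | succ n =>
        have := Q.complex_exactAt_succ n
        rw [HomologicalComplex.exactAt_iff' _ (n + 2) (n + 1) n (by simp) (by simp)] at this
        rwa [HomologicalComplex.exactAt_iff' _ (n + 3) (n + 2) (n + 1) (by simp) (by simp)])

end Splice

section TorLength

variable {R : Type u} [CommRing R]

/-- The functor `Tor` derives the tensor product in its second variable, so it is N that gets
resolved. Hence dimension shifting acts on N, while exact sequences in M come from tensoring with
one fixed resolution. -/
lemma torLength_eq_homology (M : Type u) [AddCommGroup M] [Module R M] {N : ModuleCat.{u} R}
    (P : ProjectiveResolution N) (n : ℕ) :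
    torLength R M N n = Module.length R
      ((((MonoidalCategory.tensoringLeft (ModuleCat.{u} R)).obj
        (ModuleCat.of R M)).mapHomologicalComplex _).obj P.complex |>.homology n) :=
  (P.isoLeftDerivedObj ((MonoidalCategory.tensoringLeft (ModuleCat.{u} R)).obj
        (ModuleCat.of R M)) n).toLinearEquiv.length_eq

lemma torLength_congr_right (M : Type u) [AddCommGroup M] [Module R M] {N N' : Type u}
    [AddCommGroup N] [Module R N] [AddCommGroup N'] [Module R N'] (e : N ≃ₗ[R] N') (n : ℕ) :
    torLength R M N n = torLength R M N' n :=
  (((Tor (ModuleCat.{u} R) n).obj (ModuleCat.of R M)).mapIso e.toModuleIso).toLinearEquiv.length_eq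

variable {K F N : Type u} [AddCommGroup K] [Module R K] [AddCommGroup F] [Module R F]
  [AddCommGroup N] [Module R N]

lemma ModuleCat.shortExact_of_exact {f : K →ₗ[R] F} {g : F →ₗ[R] N} (hf : Function.Injective f)
    (hfg : Function.Exact f g) (hg : Function.Surjective g) :
    (ShortComplex.mk (ModuleCat.ofHom f) (ModuleCat.ofHom g) (by
      ext x; exact hfg.apply_apply_eq_zero x)).ShortExact where
  exact := (ShortComplex.ShortExact.moduleCat_exact_iff_function_exact _).2 hfg
  mono_f := (ModuleCat.mono_iff_injective _).2 hf
  epi_g := (ModuleCat.epi_iff_surjective _).2 hg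

lemma torLength_of_projective (M : Type u) [AddCommGroup M] [Module R M] [Module.Projective R N]
    (n : ℕ) : torLength R M N (n + 1) = 0 := by
  have : Projective (ModuleCat.of R N) := (IsProjective.iff_projective N).1 inferInstance
  have h := isZero_Tor_succ_of_projective (ModuleCat.{u} R) (ModuleCat.of R M) (ModuleCat.of R N) n
  exact Module.length_eq_zero_iff.2 (ModuleCat.subsingleton_of_isZero h)

/-- Dimension shifting for `Tor`. -/
lemma torLength_succ_succ (M : Type u) [AddCommGroup M] [Module R M] [Module.Projective R F]
    {f : K →ₗ[R] F} {g : F →ₗ[R] N} (hf : Function.Injective f)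
    (hfg : Function.Exact f g) (hg : Function.Surjective g) (n : ℕ) :
    torLength R M N (n + 2) = torLength R M K (n + 1) := by
  have : Projective (ModuleCat.of R F) := (IsProjective.iff_projective F).1 inferInstance
  let Q := projectiveResolution (ModuleCat.of R K)
  have hS := ModuleCat.shortExact_of_exact hf hfg hg
  let P := @ProjectiveResolution.splice _ _ _ _ hS this Q
  rw [torLength_eq_homology M (N := ModuleCat.of R K) Q,
    torLength_eq_homology M (N := ModuleCat.of R N) P]
  -- With explicit neighbouring degrees, the spliced resolution in degree k + 1 is literally `Q` in
  -- degree k, so both short complexes coincide definitionally.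
  rw [(HomologicalComplex.homologyIsoSc' _ (n + 3) (n + 2) (n + 1)
      (by simp) (by simp)).toLinearEquiv.length_eq,
    (HomologicalComplex.homologyIsoSc' _ (n + 2) (n + 1) n (by simp) (by simp)
      ).toLinearEquiv.length_eq]
  rfl

/-- The homology of `A → B → C → D` at `B`, for `A → B → C → 0` exact, is the kernel of
`C → D`. -/
lemma length_homology_comp (S : ShortComplex (ModuleCat.{u} R)) {C : Type u} [AddCommGroup C]
    [Module R C] (b : S.X₂ →ₗ[R] C) (c : C →ₗ[R] S.X₃) (hb : Function.Surjective b)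
    (h : Function.Exact S.f.hom b) (hg : S.g.hom = c ∘ₗ b) :
    Module.length R S.homology = Module.length R (LinearMap.ker c) := by
  rw [S.moduleCatHomologyIso.toLinearEquiv.length_eq]
  let φ : LinearMap.ker S.g.hom →ₗ[R] LinearMap.ker c :=
    b.restrict (fun x hx => by simpa [hg] using hx)
  have hφ : Function.Surjective φ := by
    rintro ⟨y, hy⟩
    obtain ⟨x, rfl⟩ := hb y
    exact ⟨⟨x, by simpa [hg] using hy⟩, rfl⟩
  have hk : LinearMap.ker φ = LinearMap.range S.moduleCatToCycles := by
    ext ⟨x, hx⟩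
    have : φ ⟨x, hx⟩ = 0 ↔ b x = 0 := by
      rw [Subtype.ext_iff]; rfl
    rw [LinearMap.mem_ker, this, h x]
    constructor
    · rintro ⟨y, hy⟩; exact ⟨y, Subtype.ext hy⟩
    · rintro ⟨y, hy⟩; exact ⟨y, congrArg Subtype.val hy⟩
  exact ((Submodule.quotEquivOfEq _ _ hk.symm).trans
    (φ.quotKerEquivOfSurjective hφ)).length_eq

/-- By right exactness, M ⊗ K is the cokernel of the first differential of the tensored resolution
of K. Dividing the cycles in degree one by the boundaries therefore leaves the kernel of M ⊗ K → M ⊗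
F. -/
lemma torLength_one (M : Type u) [AddCommGroup M] [Module R M] [Module.Projective R F]
    {f : K →ₗ[R] F} {g : F →ₗ[R] N} (hf : Function.Injective f)
    (hfg : Function.Exact f g) (hg : Function.Surjective g) :
    torLength R M N 1 = Module.length R (LinearMap.ker (f.lTensor M)) := by
  have : Projective (ModuleCat.of R F) := (IsProjective.iff_projective F).1 inferInstance
  let Q := projectiveResolution (ModuleCat.of R K)
  have hS := ModuleCat.shortExact_of_exact hf hfg hg
  let P := @ProjectiveResolution.splice _ _ _ _ hS this Q
  rw [torLength_eq_homology M (N := ModuleCat.of R N) P]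
  rw [(HomologicalComplex.homologyIsoSc' _ 2 1 0
      (by simp) (by simp)).toLinearEquiv.length_eq]
  have hb : Function.Surjective (Q.aug.hom.lTensor M) :=
    LinearMap.lTensor_surjective M ((ModuleCat.epi_iff_surjective _).1 Q.epi_aug)
  have h : Function.Exact ((Q.complex.d 1 0).hom.lTensor M) (Q.aug.hom.lTensor M) :=
    lTensor_exact M ((ShortComplex.ShortExact.moduleCat_exact_iff_function_exact _).1 Q.exact_aug)
      ((ModuleCat.epi_iff_surjective _).1 Q.epi_aug)
  let S : ShortComplex (ModuleCat.{u} R) := ShortComplex.mk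
    (ModuleCat.ofHom ((Q.complex.d 1 0).hom.lTensor M))
    (ModuleCat.ofHom (f.lTensor M ∘ₗ Q.aug.hom.lTensor M)) (by
      refine ModuleCat.hom_ext (LinearMap.ext fun x => ?_)
      change f.lTensor M (Q.aug.hom.lTensor M ((Q.complex.d 1 0).hom.lTensor M x)) = 0
      rw [h.apply_apply_eq_zero, map_zero])
  have key := length_homology_comp S (Q.aug.hom.lTensor M) (f.lTensor M) hb h rfl
  rw [← key]
  let C := ((MonoidalCategory.tensoringLeft (ModuleCat.{u} R)).obj
    (ModuleCat.of R M)).mapHomologicalComplex (ComplexShape.down ℕ) |>.obj P.complex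
  refine (ShortComplex.homologyMapIso (ShortComplex.isoMk (S₁ := C.sc' 2 1 0) (S₂ := S) (Iso.refl _)
    (Iso.refl _) (Iso.refl _) ?_ ?_)).toLinearEquiv.length_eq
  · exact (Category.id_comp _).trans (Category.comp_id _).symm
  · refine (Category.id_comp _).trans (Eq.trans ?_ (Category.comp_id _).symm)
    apply ModuleCat.hom_ext
    exact (LinearMap.lTensor_comp M f Q.aug.hom).symm

end TorLength

/-! ### Long exact sequence and additivity of θ -/

section LongExactSequence

variable {R : Type u} [CommRing R] {M₁ M₂ M₃ : Type u} [AddCommGroup M₁] [Module R M₁]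
  [AddCommGroup M₂] [Module R M₂] [AddCommGroup M₃] [Module R M₃]

/-- The long exact sequence of `Tor` in the first variable. -/
lemma exists_tor_long_exact (N : Type u) [AddCommGroup N] [Module R N]
    {f : M₁ →ₗ[R] M₂} {g : M₂ →ₗ[R] M₃} (hf : Function.Injective f)
    (hfg : Function.Exact f g) (hg : Function.Surjective g) :
    ∃ (T₁ T₂ T₃ : ℕ → ModuleCat.{u} R) (a : ∀ n, T₁ n →ₗ[R] T₂ n) (b : ∀ n, T₂ n →ₗ[R] T₃ n)
      (δ : ∀ n, T₃ (n + 1) →ₗ[R] T₁ n),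
      (∀ n, Module.length R (T₁ n) = torLength R M₁ N n) ∧
      (∀ n, Module.length R (T₂ n) = torLength R M₂ N n) ∧
      (∀ n, Module.length R (T₃ n) = torLength R M₃ N n) ∧
      (∀ n, Function.Exact (a n) (b n)) ∧ (∀ n, Function.Exact (b (n + 1)) (δ n)) ∧
      (∀ n, Function.Exact (δ n) (a n)) := by
  let P := projectiveResolution (ModuleCat.of R N)
  let Φ (M : ModuleCat.{u} R) := ((MonoidalCategory.tensoringLeft (ModuleCat.{u} R)).obj M)
  let α : Φ (.of R M₁) ⟶ Φ (.of R M₂) :=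
    (MonoidalCategory.tensoringLeft (ModuleCat.{u} R)).map (ModuleCat.ofHom f)
  let β : Φ (.of R M₂) ⟶ Φ (.of R M₃) :=
    (MonoidalCategory.tensoringLeft (ModuleCat.{u} R)).map (ModuleCat.ofHom g)
  let A := (NatTrans.mapHomologicalComplex α (ComplexShape.down ℕ)).app P.complex
  let B := (NatTrans.mapHomologicalComplex β (ComplexShape.down ℕ)).app P.complex
  have w : A ≫ B = 0 := by
    ext i : 1
    change (ModuleCat.ofHom (f.rTensor (P.complex.X i))) ≫
      (ModuleCat.ofHom (g.rTensor (P.complex.X i))) = 0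
    rw [← ModuleCat.ofHom_comp, ← LinearMap.rTensor_comp, hfg.linearMap_comp_eq_zero]
    ext; simp
  have hS : (ShortComplex.mk A B w).ShortExact := by
    refine HomologicalComplex.shortExact_of_degreewise_shortExact _ fun i => ?_
    have : Module.Projective R (P.complex.X i) :=
      (IsProjective.iff_projective _).2 (P.projective i)
    exact ModuleCat.shortExact_of_exact
      (Module.Flat.rTensor_preserves_injective_linearMap (M := P.complex.X i) f hf)
      (rTensor_exact (P.complex.X i) hfg hg) (LinearMap.rTensor_surjective (P.complex.X i) hg)
  refine ⟨fun n => HomologicalComplex.homology _ n, fun n => HomologicalComplex.homology _ n,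
    fun n => HomologicalComplex.homology _ n,
    fun n => (HomologicalComplex.homologyMap A n).hom,
    fun n => (HomologicalComplex.homologyMap B n).hom,
    fun n => (hS.δ (n + 1) n rfl).hom, fun n => (torLength_eq_homology M₁ P n).symm,
    fun n => (torLength_eq_homology M₂ P n).symm, fun n => (torLength_eq_homology M₃ P n).symm,
    fun n => ?_, fun n => ?_, fun n => ?_⟩
  · exact (ShortComplex.ShortExact.moduleCat_exact_iff_function_exact _).1 (hS.homology_exact₂ n)
  · exact (ShortComplex.ShortExact.moduleCat_exact_iff_function_exact _).1
      (hS.homology_exact₃ (n + 1) n rfl)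
  · exact (ShortComplex.ShortExact.moduleCat_exact_iff_function_exact _).1
      (hS.homology_exact₁ (n + 1) n rfl)

end LongExactSequence

section ThetaAdditive

variable {R : Type u} [CommRing R]

/-- Stabilising the second variable by a projective summand does not change the higher `Tor`. -/
lemma torLength_prod_projective (M N F : Type u) [AddCommGroup M] [Module R M] [AddCommGroup N]
    [Module R N] [AddCommGroup F] [Module R F] [Module.Projective R F] (n : ℕ) :
    torLength R M (N × F) (n + 2) = torLength R M N (n + 2) := by
  let π := Finsupp.linearCombination R (id : N → N)
  have hπ : Function.Surjective π := Finsupp.linearCombination_id_surjective R N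
  have hN : torLength R M N (n + 2) = torLength R M (LinearMap.ker π) (n + 1) :=
    torLength_succ_succ (K := LinearMap.ker π) (F := N →₀ R) M (f := (LinearMap.ker π).subtype)
      (g := π) Subtype.val_injective (LinearMap.exact_subtype_ker_map π) hπ n
  rw [hN]
  -- Covering the summand F by itself leaves the first syzygy of N unchanged.
  refine torLength_succ_succ M (F := (N →₀ R) × F)
    (f := LinearMap.inl R _ F ∘ₗ (LinearMap.ker π).subtype) (g := π.prodMap LinearMap.id) ?_ ?_ ?_ n
  · exact LinearMap.inl_injective.comp (LinearMap.ker π).injective_subtype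
  · rintro ⟨x, y⟩
    simp only [LinearMap.prodMap_apply, LinearMap.id_apply, Prod.mk_eq_zero]
    constructor
    · rintro ⟨hx, rfl⟩
      exact ⟨⟨x, hx⟩, rfl⟩
    · rintro ⟨z, hz⟩
      obtain ⟨rfl, rfl⟩ := Prod.ext_iff.1 hz
      exact ⟨z.2, rfl⟩
  · exact hπ.prodMap Function.surjective_id

variable {M₁ M₂ M₃ : Type u} [AddCommGroup M₁] [Module R M₁]
  [AddCommGroup M₂] [Module R M₂] [AddCommGroup M₃] [Module R M₃]

lemma Module.length_eq_range_add_range {A B C : Type*} [AddCommGroup A] [Module R A]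
    [AddCommGroup B] [Module R B] [AddCommGroup C] [Module R C] {f : A →ₗ[R] B} {g : B →ₗ[R] C}
    (h : Function.Exact f g) :
    Module.length R B = Module.length R (LinearMap.range f) + Module.length R (LinearMap.range g) :=
  Module.length_eq_add_of_exact (LinearMap.range f).subtype g.rangeRestrict
    (Submodule.injective_subtype _) g.surjective_rangeRestrict (by
      rw [LinearMap.exact_iff, LinearMap.ker_rangeRestrict, Submodule.range_subtype]
      exact LinearMap.exact_iff.1 h)

lemma Module.length_range_le {A B : Type*} [AddCommGroup A] [Module R A]
    [AddCommGroup B] [Module R B] (f : A →ₗ[R] B) :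
    Module.length R (LinearMap.range f) ≤ Module.length R B :=
  Module.length_le_of_injective _ (LinearMap.range f).injective_subtype

/-- The defect of additivity of the lengths of `Tor` in a short exact sequence. -/
lemma exists_torLength_defect (N : Type u) [AddCommGroup N] [Module R N]
    {f : M₁ →ₗ[R] M₂} {g : M₂ →ₗ[R] M₃} (hf : Function.Injective f)
    (hfg : Function.Exact f g) (hg : Function.Surjective g)
    (h₁ : ∀ n, torLength R M₁ N (n + 1) ≠ ⊤) (h₂ : ∀ n, torLength R M₂ N (n + 1) ≠ ⊤)
    (h₃ : ∀ n, torLength R M₃ N (n + 1) ≠ ⊤) :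
    ∃ d : ℕ → ℕ, (∀ n, (torLength R M₁ N (n + 1)).toNat + (torLength R M₃ N (n + 1)).toNat =
        (torLength R M₂ N (n + 1)).toNat + d n + d (n + 1)) ∧
      ∀ n, d (n + 1) ≤ (torLength R M₁ N (n + 1)).toNat := by
  obtain ⟨T₁, T₂, T₃, a, b, δ, e₁, e₂, e₃, hab, hbδ, hδa⟩ := exists_tor_long_exact N hf hfg hg
  refine ⟨fun n => (Module.length R (LinearMap.range (δ n))).toNat, fun n => ?_, fun n => ?_⟩
  · have k₁ := Module.length_eq_range_add_range (hδa (n + 1))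
    have k₂ := Module.length_eq_range_add_range (hab (n + 1))
    have k₃ := Module.length_eq_range_add_range (hbδ n)
    have f₁ := h₁ n
    have f₂ := h₂ n
    have f₃ := h₃ n
    rw [← e₁, k₁] at f₁ ⊢
    rw [← e₂, k₂] at f₂ ⊢
    rw [← e₃, k₃] at f₃ ⊢
    simp only [ne_eq, ENat.add_eq_top, not_or] at f₁ f₂ f₃
    rw [ENat.toNat_add f₁.1 f₁.2, ENat.toNat_add f₂.1 f₂.2, ENat.toNat_add f₃.1 f₃.2]
    dsimp only
    omega
  · rw [← e₁]
    exact ENat.toNat_le_toNat (Module.length_range_le _) (e₁ _ ▸ h₁ n)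

/-- Here d n is the rank of a connecting map. Periodicity of the p's makes d n + d (n + 1) periodic,
so d (n + 2) - d n only changes sign with n. Along one parity class d is then an arithmetic
progression; it lies between 0 and a periodic bound, so its step C is zero, and the defects cancel
in the difference. -/
lemma alternating_additive_of_periodic {p₁ p₂ p₃ d : ℕ → ℕ}
    (h : ∀ n, p₁ n + p₃ n = p₂ n + d n + d (n + 1)) (hd : ∀ n, d (n + 1) ≤ p₁ n) {n₀ : ℕ}
    (h₁ : ∀ n, n₀ ≤ n → p₁ (n + 2) = p₁ n) (h₂ : ∀ n, n₀ ≤ n → p₂ (n + 2) = p₂ n)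
    (h₃ : ∀ n, n₀ ≤ n → p₃ (n + 2) = p₃ n) {n : ℕ} (hn : n₀ ≤ n) :
    (p₂ (n + 1) : ℤ) - p₂ n = (p₁ (n + 1) - p₁ n) + (p₃ (n + 1) - p₃ n) := by
  have hD : ∀ m, n₀ ≤ m → (d (m + 3) : ℤ) - d (m + 1) = - (d (m + 2) - d m) := by
    intro m hm
    have := h m; have := h (m + 2); have := h₁ m hm; have := h₂ m hm; have := h₃ m hm
    rw [show m + 2 + 1 = m + 3 by ring] at *
    omega
  set C : ℤ := d (n + 2) - d n with hC
  have hk : ∀ k, (d (n + 2 * k) : ℤ) = d n + k * C ∧ (d (n + 2 * k + 2) : ℤ) - d (n + 2 * k) = C := by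
    intro k
    induction k with
    | zero => simp [hC]
    | succ k ih =>
      have a := hD (n + 2 * k) (by omega)
      have b := hD (n + 2 * k + 1) (by omega)
      rw [show n + 2 * k + 1 + 3 = n + 2 * (k + 1) + 2 by ring,
        show n + 2 * k + 1 + 1 = n + 2 * (k + 1) by ring,
        show n + 2 * k + 1 + 2 = n + 2 * k + 3 by ring] at b
      rw [show n + 2 * k + 2 = n + 2 * (k + 1) by ring] at ih a
      obtain ⟨i1, i2⟩ := ih
      refine ⟨?_, by linarith⟩
      push_cast
      linarith
  have hp : ∀ k, p₁ (n + 1 + 2 * k) = p₁ (n + 1) := by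
    intro k
    induction k with
    | zero => rfl
    | succ k ih => rw [← ih, ← h₁ (n + 1 + 2 * k) (by omega)]; congr 1
  have hb : ∀ k : ℕ, (d n : ℤ) + (k + 1) * C ≤ p₁ (n + 1) := by
    intro k
    have := (hk (k + 1)).1
    have h' := hd (n + 1 + 2 * k)
    rw [hp, show n + 1 + 2 * k + 1 = n + 2 * (k + 1) by ring] at h'
    push_cast at this
    linarith [(Nat.cast_le (α := ℤ)).2 h']
  have hb' : ∀ k : ℕ, 0 ≤ (d n : ℤ) + k * C := fun k => by
    rw [← (hk k).1]; positivity
  have hC0 : C = 0 := by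
    rcases lt_trichotomy C 0 with hlt | h0 | hgt
    · have := hb' (d n + 1)
      push_cast at this
      nlinarith
    · exact h0
    · have := hb (p₁ (n + 1))
      nlinarith [(Nat.cast_nonneg (α := ℤ) (p₁ (n + 1))), (Nat.cast_nonneg (α := ℤ) (d n))]
  have := h n
  have := h (n + 1)
  rw [show n + 1 + 1 = n + 2 by ring] at this
  omega

/-- Additivity of `θ` in the first variable. -/
lemma hochsterThetaAt_additive (N : Type u) [AddCommGroup N] [Module R N]
    {f : M₁ →ₗ[R] M₂} {g : M₂ →ₗ[R] M₃} (hf : Function.Injective f)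
    (hfg : Function.Exact f g) (hg : Function.Surjective g)
    (h₁ : ∀ n, torLength R M₁ N (n + 1) ≠ ⊤) (h₂ : ∀ n, torLength R M₂ N (n + 1) ≠ ⊤)
    (h₃ : ∀ n, torLength R M₃ N (n + 1) ≠ ⊤) {n₀ : ℕ}
    (p₁ : ∀ n, n₀ ≤ n → torLength R M₁ N (n + 2) = torLength R M₁ N n)
    (p₂ : ∀ n, n₀ ≤ n → torLength R M₂ N (n + 2) = torLength R M₂ N n)
    (p₃ : ∀ n, n₀ ≤ n → torLength R M₃ N (n + 2) = torLength R M₃ N n)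
    {e : ℕ} (he : n₀ ≤ 2 * e + 1) :
    hochsterThetaAt R M₂ N e = hochsterThetaAt R M₁ N e + hochsterThetaAt R M₃ N e := by
  obtain ⟨d, hd, hd'⟩ := exists_torLength_defect N hf hfg hg h₁ h₂ h₃
  -- The sequences start at Tor_1: index n stands for Tor_{n+1}, whence `n₀ - 1`, and n = 2e gives
  -- Tor_{2e+2} minus Tor_{2e+1}.
  exact alternating_additive_of_periodic hd hd' (n₀ := n₀ - 1)
    (fun n hn => congrArg ENat.toNat (p₁ (n + 1) (by omega)))
    (fun n hn => congrArg ENat.toNat (p₂ (n + 1) (by omega)))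
    (fun n hn => congrArg ENat.toNat (p₃ (n + 1) (by omega))) (n := 2 * e) (by omega)

end ThetaAdditive

/-! ### Local rings with maximal ideal generated by one or two elements -/

section TwoGenerated

open IsLocalRing

variable {T : Type*} [CommRing T] [IsLocalRing T] [IsNoetherianRing T]

/-- If the maximal ideal is `(u, v)`, the only non-maximal prime that can contain `u` is `(u)`. -/
lemma Ideal.IsPrime.eq_span_singleton_of_mem {u v : T} (hm : maximalIdeal T = Ideal.span {u, v})
    {Q : Ideal T} (hQ : Q.IsPrime) (hu : u ∈ Q) (hne : Q ≠ maximalIdeal T) :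
    Q = Ideal.span {u} := by
  refine le_antisymm ?_ ((Ideal.span_singleton_le_iff_mem _).2 hu)
  have hv : v ∉ Q := fun hv => hne (le_antisymm (le_maximalIdeal hQ.ne_top)
    (hm ▸ Ideal.span_le.2 (by rintro x (rfl | rfl) <;> assumption)))
  have hvm : v ∈ maximalIdeal T := hm ▸ Ideal.subset_span (by simp)
  -- Nakayama: it is enough that Q ≤ (u) + mQ. Write a = cu + dv in Q; as v ∉ Q, the coefficient d
  -- lies in Q.
  refine Submodule.le_of_le_smul_of_le_jacobson_bot (I := maximalIdeal T) (N' := Q)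
    (IsNoetherian.noetherian Q) (maximalIdeal_le_jacobson _) fun a ha => ?_
  obtain ⟨c, d, rfl⟩ := Ideal.mem_span_pair.1 (hm ▸ le_maximalIdeal hQ.ne_top ha)
  refine Submodule.add_mem_sup (Ideal.mul_mem_left _ _ (Ideal.mem_span_singleton_self u)) ?_
  have hd : d ∈ Q := (hQ.mem_or_mem ((Ideal.add_mem_iff_right _ (Ideal.mul_mem_left _ c hu)).1 ha)
    ).resolve_right hv
  rw [mul_comm]
  exact Ideal.mul_mem_mul hvm hd

lemma Ideal.IsPrime.eq_bot_of_maximalIdeal_eq_span_singleton {x : T}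
    (hm : maximalIdeal T = Ideal.span {x}) {Q : Ideal T} (hQ : Q.IsPrime)
    (hne : Q ≠ maximalIdeal T) : Q = ⊥ := by
  have := hQ.eq_span_singleton_of_mem (u := 0) (v := x) (by rw [hm]; simp) Q.zero_mem hne
  simpa using this

/-- A two-dimensional Noetherian local ring with maximal ideal `(u, v)` is a domain in which `u`
generates a prime ideal that does not contain `v`. -/
lemma isDomain_of_maximalIdeal_eq_span_pair {u v : T} (hm : maximalIdeal T = Ideal.span {u, v})
    (hdim : 2 ≤ ringKrullDim T) :
    IsDomain T ∧ u ≠ 0 ∧ (Ideal.span {u}).IsPrime ∧ v ∉ Ideal.span {u} := by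
  obtain ⟨l, hl⟩ := Order.le_krullDim_iff.1 (show ((2 : ℕ) : WithBot ℕ∞) ≤ _ from hdim)
  let q (i : Fin 3) : PrimeSpectrum T := l ⟨i, by omega⟩
  have h01 : (q 0).asIdeal < (q 1).asIdeal := l.strictMono (Fin.mk_lt_mk.2 (by simp))
  have h12 : (q 1).asIdeal < (q 2).asIdeal := l.strictMono (Fin.mk_lt_mk.2 (by simp))
  have h1m : (q 1).asIdeal < maximalIdeal T := h12.trans_le (le_maximalIdeal (q 2).2.ne_top)
  have hum : u ∈ maximalIdeal T := hm ▸ Ideal.subset_span (by simp)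
  -- Krull's principal ideal theorem modulo q 0: were the maximal ideal minimal over q 0 + (u), no
  -- prime could lie strictly between it and q 0, yet q 1 does.
  have hnot : maximalIdeal T ∉ (Ideal.span (insert u ((q 0).asIdeal : Set T))).minimalPrimes := by
    intro h
    have := Ideal.mem_minimalPrimes_span_of_mem_minimalPrimes_span_insert h1m u _ h
      ((q 0).asIdeal : Set T) h01.le
      (fun x hx => Ideal.le_radical (Ideal.subset_span (Set.mem_insert_of_mem _ hx)))
    exact h01.not_ge (this.2 ⟨(q 0).2, by rw [Ideal.span_eq]⟩ h01.le)
  have hle : Ideal.span (insert u ((q 0).asIdeal : Set T)) ≤ maximalIdeal T :=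
    Ideal.span_le.2 (Set.insert_subset hum (h01.trans h1m).le)
  obtain ⟨P, hP, hPm⟩ := Ideal.exists_minimalPrimes_le hle
  have hPne : P ≠ maximalIdeal T := fun h => hnot (h ▸ hP)
  have huP : u ∈ P := hP.1.2 (Ideal.subset_span (Set.mem_insert _ _))
  have hPu := hP.1.1.eq_span_singleton_of_mem hm huP hPne
  have hup : (Ideal.span {u}).IsPrime := hPu ▸ hP.1.1
  have h0u : (q 0).asIdeal ≤ Ideal.span {u} :=
    hPu ▸ fun x hx => hP.1.2 (Ideal.subset_span (Set.mem_insert_of_mem _ hx))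
  have hu0 : u ∉ (q 0).asIdeal := by
    intro h
    have h0 := (q 0).2.eq_span_singleton_of_mem hm h (h01.trans h1m).ne
    have h1 := (q 1).2.eq_span_singleton_of_mem hm (h01.le h) h1m.ne
    exact h01.ne (h0.trans h1.symm)
  -- Elements of q 0 are multiples uc, and u ∉ q 0 puts c in q 0. So q 0 = u · q 0, and Nakayama
  -- applies.
  have hbot : (q 0).asIdeal = ⊥ := by
    refine Submodule.eq_bot_of_le_smul_of_le_jacobson_bot (maximalIdeal T) _
      (IsNoetherian.noetherian _) (fun a ha => ?_) (maximalIdeal_le_jacobson _)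
    obtain ⟨c, rfl⟩ := Ideal.mem_span_singleton.1 (h0u ha)
    exact Ideal.mul_mem_mul hum (((q 0).2.mem_or_mem ha).resolve_left hu0)
  refine ⟨?_, fun h => hu0 (h ▸ (q 0).asIdeal.zero_mem), hup, fun hv => hPne (le_antisymm hPm (hm ▸ Ideal.span_le.2 ?_))⟩
  · have : (⊥ : Ideal T).IsPrime := hbot ▸ (q 0).2
    exact IsDomain.of_bot_isPrime T
  · rw [hPu]
    rintro x (rfl | rfl)
    exacts [Ideal.mem_span_singleton_self _, hv]

omit [IsLocalRing T] [IsNoetherianRing T] in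
/-- The Koszul relations are the only relations between `u` and `v`. -/
lemma exists_of_mul_add_mul_eq_zero [IsDomain T] {u v : T} (hu0 : u ≠ 0)
    (hu : (Ideal.span {u}).IsPrime)
    (hv : v ∉ Ideal.span {u}) (a b : T) (h : u * a + v * b = 0) :
    ∃ c, a = v * c ∧ b = -(u * c) := by
  have : v * b ∈ Ideal.span {u} := by
    rw [Ideal.mem_span_singleton]
    exact ⟨-a, by linear_combination h⟩
  obtain ⟨c, rfl⟩ := Ideal.mem_span_singleton.1 ((hu.mem_or_mem this).resolve_left hv)
  refine ⟨-c, mul_left_cancel₀ hu0 (by linear_combination h), by ring⟩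

omit [IsNoetherianRing T] in
/-- A finitely presented submodule of "depth two" of a module of "depth two" is free. -/
lemma free_of_depth_two {u v : T} (hm : maximalIdeal T = Ideal.span {u, v}) {F : Type*}
    [AddCommGroup F] [Module T F]
    (hF : ∀ a b : F, u • a + v • b = 0 → ∃ c, a = v • c ∧ b = -(u • c)) (G : Submodule T F)
    [Module.FinitePresentation T G] (hG : ∀ w : F, u • w ∈ G → v • w ∈ G → w ∈ G) :
    Module.Free T G := by
  refine Module.free_of_maximalIdeal_rTensor_injective
    ((injective_iff_map_eq_zero _).2 fun z hz => ?_)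
  have hum : u ∈ maximalIdeal T := hm ▸ Ideal.subset_span (by simp)
  have hvm : v ∈ maximalIdeal T := hm ▸ Ideal.subset_span (by simp)
  let u' : maximalIdeal T := ⟨u, hum⟩
  let v' : maximalIdeal T := ⟨v, hvm⟩
  have key : ∃ g h : G, z = u' ⊗ₜ g + v' ⊗ₜ h := by
    clear hz
    induction z with
    | zero => exact ⟨0, 0, by simp⟩
    | add x y hx hy =>
      obtain ⟨g, h, rfl⟩ := hx
      obtain ⟨g', h', rfl⟩ := hy
      exact ⟨g + g', h + h', by simp only [tmul_add]; abel⟩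
    | tmul x y =>
      obtain ⟨x, hx⟩ := x
      obtain ⟨c, d, hcd⟩ := Ideal.mem_span_pair.1 (hm ▸ hx)
      refine ⟨c • y, d • y, ?_⟩
      have : (⟨x, hx⟩ : maximalIdeal T) = c • u' + d • v' := Subtype.ext hcd.symm
      rw [this, add_tmul, smul_tmul, smul_tmul]
  obtain ⟨g, h, rfl⟩ := key
  have h0 : u • (g : F) + v • (h : F) = 0 := by
    have := congrArg (fun t => ((TensorProduct.lid T G t : G) : F)) hz
    simpa [u', v'] using this
  obtain ⟨c, hc, hd⟩ := hF _ _ h0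
  -- The Koszul coefficient c is only known to lie in F; both u • c = -h and v • c = g lie in G, so
  -- the saturation hypothesis applies. Then u ⊗ g + v ⊗ h = u ⊗ vc - v ⊗ uc vanishes.
  have hcG : c ∈ G := hG c (by rw [← neg_mem_iff, ← hd]; exact h.2) (hc ▸ g.2)
  have hg : g = v • (⟨c, hcG⟩ : G) := Subtype.ext hc
  have hh : h = -(u • (⟨c, hcG⟩ : G)) := Subtype.ext hd
  have huv : v • u' = u • v' := Subtype.ext (mul_comm v u)
  rw [hg, hh, tmul_neg, ← smul_tmul, ← smul_tmul, huv, add_neg_cancel]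

-- Every tensor in m ⊗ N has the form y ⊗ g, and its image yg vanishes only if g = 0; so m ⊗ N → N
-- is injective, which is the local criterion for freeness.
omit [IsNoetherianRing T] in
lemma free_of_maximalIdeal_eq_span_singleton {y : T} (hm : maximalIdeal T = Ideal.span {y})
    (N : Type*) [AddCommGroup N] [Module T N] [Module.FinitePresentation T N]
    (hN : IsSMulRegular N y) : Module.Free T N := by
  refine Module.free_of_maximalIdeal_rTensor_injective
    ((injective_iff_map_eq_zero _).2 fun z hz => ?_)
  have hym : y ∈ maximalIdeal T := hm ▸ Ideal.mem_span_singleton_self y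
  have key : ∃ g : N, z = (⟨y, hym⟩ : maximalIdeal T) ⊗ₜ g := by
    clear hz
    induction z with
    | zero => exact ⟨0, by simp⟩
    | add a b ha hb =>
      obtain ⟨g, rfl⟩ := ha
      obtain ⟨g', rfl⟩ := hb
      exact ⟨g + g', by rw [tmul_add]⟩
    | tmul a b =>
      obtain ⟨a, ha⟩ := a
      obtain ⟨c, rfl⟩ := Ideal.mem_span_singleton'.1 (hm ▸ ha)
      refine ⟨c • b, ?_⟩
      rw [← smul_tmul]
      rfl
  obtain ⟨g, rfl⟩ := key
  have h0 : y • g = y • 0 := by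
    simpa using congrArg (TensorProduct.lid T N) hz
  rw [hN h0, tmul_zero]

-- Two distinct basis elements s, t of an ideal would satisfy the nontrivial relation s · t = t · s,
-- so a basis has at most one element.
omit [IsLocalRing T] [IsNoetherianRing T] in
lemma Ideal.isPrincipal_of_free [Nontrivial T] (I : Ideal T) [Module.Free T I] :
    I.IsPrincipal := by
  let b := Module.Free.chooseBasis T I
  have hsub : Subsingleton (Module.Free.ChooseBasisIndex T I) := by
    refine ⟨fun i j => ?_⟩
    by_contra hij
    have h : (b j : T) • b i = (b i : T) • b j := Subtype.ext (mul_comm _ _)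
    have := congrArg (fun x => b.repr x i) h
    simp only [map_smul, Module.Basis.repr_self, Finsupp.smul_apply, Finsupp.single_eq_same,
      smul_eq_mul, mul_one] at this
    rw [Finsupp.single_eq_of_ne hij, mul_zero] at this
    exact b.ne_zero j (Subtype.ext this)
  rcases isEmpty_or_nonempty (Module.Free.ChooseBasisIndex T I) with he | ⟨⟨i⟩⟩
  · have : Subsingleton I := b.repr.toEquiv.subsingleton
    rw [Submodule.subsingleton_iff_eq_bot.1 this]
    infer_instance
  · refine ⟨⟨(b i : T), le_antisymm (fun x hx => ?_) ?_⟩⟩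
    · have : Unique (Module.Free.ChooseBasisIndex T I) := ⟨⟨i⟩, fun j => hsub.elim _ _⟩
      have := b.sum_repr ⟨x, hx⟩
      rw [Fintype.sum_unique, Subtype.ext_iff] at this
      rw [Submodule.mem_span_singleton]
      refine ⟨b.repr ⟨x, hx⟩ default, Eq.trans ?_ this⟩
      rw [Subsingleton.elim i default]
      rfl
    · exact (Ideal.span_singleton_le_iff_mem _).2 (b i).2

end TwoGenerated

/-! ### Schanuel's lemma and matrix factorizations -/

section Schanuel

/-- Schanuel's lemma. -/
lemma schanuel {B P Q K : Type*} [CommRing B] [AddCommGroup P] [Module B P] [AddCommGroup Q]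
    [Module B Q] [AddCommGroup K] [Module B K] [Module.Projective B P] [Module.Projective B Q]
    {p : P →ₗ[B] K} {q : Q →ₗ[B] K} (hp : Function.Surjective p) (hq : Function.Surjective q) :
    Nonempty ((LinearMap.ker p × Q) ≃ₗ[B] (LinearMap.ker q × P)) := by
  obtain ⟨σ, hσ⟩ := Module.projective_lifting_property q p hq
  obtain ⟨τ, hτ⟩ := Module.projective_lifting_property p q hp
  have hσ' (x) : q (σ x) = p x := LinearMap.congr_fun hσ x
  have hτ' (x) : p (τ x) = q x := LinearMap.congr_fun hτ x
  -- Both sides parametrize the fibre product of P and Q over K: (a, y) corresponds to the pair (a +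
  -- τ y, y).
  refine ⟨⟨⟨⟨fun a => (⟨a.2 - σ (a.1 + τ a.2), ?_⟩, a.1 + τ a.2), ?_⟩, ?_⟩,
    fun a => (⟨a.2 - τ (a.1 + σ a.2), ?_⟩, a.1 + σ a.2), ?_, ?_⟩⟩
  · have := a.1.2
    simp_all
  · intro a b
    ext <;> simp <;> abel
  · intro r a
    ext <;> simp [smul_sub, smul_add]
  · have := a.1.2
    simp_all
  · intro a
    ext <;> simp
  · intro a
    ext <;> simp

end Schanuel

section HypersurfaceSyzygy

variable {T B : Type*} [CommRing T] [Nontrivial T] [CommRing B] [Algebra T B]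

/-- The matrix factorization argument: let `B = T / (f)` and let `π : B ^ n → L` be a surjection.
If the kernel of `T ^ n → L` is free, then `ker π` is the image of a finite free `B`-module with
kernel `L`. -/
lemma exists_periodic_presentation (hsurj : Function.Surjective (algebraMap T B)) {f : T}
    (hker : RingHom.ker (algebraMap T B) = Ideal.span {f}) (hf : f ∈ nonZeroDivisors T)
    {L : Type*} [AddCommGroup L] [Module B L] [Module T L] [IsScalarTower T B L]
    {n : ℕ} (π : (Fin n → B) →ₗ[B] L) (hπ : Function.Surjective π)
    (ρ : (Fin n → T) →ₗ[T] L) (hρ : ∀ w, ρ w = π (fun i => algebraMap T B (w i)))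
    [Module.Free T (LinearMap.ker ρ)] [Module.Finite T (LinearMap.ker ρ)] :
    ∃ (r : ℕ) (q : (Fin r → B) →ₗ[B] LinearMap.ker π), Function.Surjective q ∧
      Nonempty (LinearMap.ker q ≃ₗ[B] L) := by
  classical
  let r := Module.finrank T (LinearMap.ker ρ)
  let β : (Fin r → T) ≃ₗ[T] LinearMap.ker ρ :=
    (Module.finBasis T (LinearMap.ker ρ)).equivFun.symm
  have hft (t : T) : algebraMap T B t = 0 ↔ ∃ c, t = f * c := by
    rw [← RingHom.mem_ker, hker, Ideal.mem_span_singleton]; rfl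
  have hfn {k : ℕ} (w : Fin k → T) : (fun i => algebraMap T B (w i)) = 0 ↔ ∃ c, w = f • c := by
    constructor
    · intro h
      choose c hc using fun i => (hft (w i)).1 (congrFun h i)
      exact ⟨c, funext hc⟩
    · rintro ⟨c, rfl⟩
      exact funext fun i => (hft _).2 ⟨c i, rfl⟩
  have hf0 {k : ℕ} {w w' : Fin k → T} (h : f • w = f • w') : w = w' :=
    funext fun i => (mul_cancel_left_mem_nonZeroDivisors hf).1 (congrFun h i)
  let red (k : ℕ) : (Fin k → T) →ₗ[T] (Fin k → B) :=
    LinearMap.pi fun i => Algebra.linearMap T B ∘ₗ LinearMap.proj i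
  have hred (k : ℕ) (w : Fin k → T) : red k w = fun i => algebraMap T B (w i) := rfl
  have hreds (k : ℕ) : Function.Surjective (red k) := fun w => by
    choose w' hw' using fun i => hsurj (w i)
    exact ⟨w', funext hw'⟩
  let γ (j : Fin r) : LinearMap.ker π :=
    ⟨red n (β (Pi.single j 1)), by
      rw [LinearMap.mem_ker, hred, ← hρ]; exact (β (Pi.single j 1)).2⟩
  let q : (Fin r → B) →ₗ[B] LinearMap.ker π := Fintype.linearCombination B γ
  have hq (c : Fin r → T) : (q (red r c) : Fin n → B) = red n (β c) := by
    conv_rhs => rw [pi_eq_sum_univ' c]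
    simp only [q, Fintype.linearCombination_apply, map_sum, map_smul, Submodule.coe_sum,
      Submodule.coe_smul]
    exact Finset.sum_congr rfl fun i _ => algebraMap_smul B (c i) _
  have hqs : Function.Surjective q := by
    rintro ⟨x, hx⟩
    obtain ⟨w, rfl⟩ := hreds n x
    have hw : w ∈ LinearMap.ker ρ := by rw [LinearMap.mem_ker, hρ, ← hred]; exact hx
    refine ⟨red r (β.symm ⟨w, hw⟩), Subtype.ext ?_⟩
    rw [hq, LinearEquiv.apply_symm_apply]
  have hfG (w : Fin n → T) : f • w ∈ LinearMap.ker ρ := by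
    rw [LinearMap.mem_ker, hρ, (hfn (f • w)).2 ⟨w, rfl⟩, map_zero]
  -- The pair (β, β⁻¹ ∘ f) is the matrix factorization of f. Its second member, reduced modulo f, is
  -- `lam`; cancelling f shows that `lam` has kernel ker ρ and image ker q, so ker q ≅ T^n / ker ρ ≅
  -- L.
  let φ : (Fin n → T) →ₗ[T] LinearMap.ker ρ := (LinearMap.lsmul T _ f).codRestrict _ hfG
  let lam : (Fin n → T) →ₗ[T] (Fin r → B) := red r ∘ₗ β.symm.toLinearMap ∘ₗ φ
  have hlk : LinearMap.ker lam = LinearMap.ker ρ := by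
    ext w
    have : lam w = 0 ↔ ∃ c, β.symm (φ w) = f • c := hfn _
    rw [LinearMap.mem_ker, this]
    constructor
    · rintro ⟨c, hc⟩
      rw [LinearEquiv.symm_apply_eq, map_smul, Subtype.ext_iff] at hc
      rw [hf0 (hc : f • w = f • (β c : Fin n → T))]
      exact (β c).2
    · intro hw
      refine ⟨β.symm ⟨w, hw⟩, ?_⟩
      rw [← map_smul]
      congr 1
  have hlr : LinearMap.range lam = (LinearMap.ker q).restrictScalars T := by
    ext c
    obtain ⟨c, rfl⟩ := hreds r c
    rw [LinearMap.mem_range, Submodule.restrictScalars_mem, LinearMap.mem_ker, Subtype.ext_iff, hq]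
    rw [Submodule.coe_zero, hred n, hfn]
    constructor
    · rintro ⟨w, hw⟩
      have : red r (β.symm (φ w) - c) = 0 := by rw [map_sub, sub_eq_zero]; exact hw
      obtain ⟨c', hc'⟩ : ∃ c', β.symm (φ w) - c = f • c' := (hfn _).1 this
      refine ⟨w - β c', ?_⟩
      have := congrArg β hc'
      rw [map_sub, LinearEquiv.apply_symm_apply, map_smul, Subtype.ext_iff] at this
      rw [smul_sub]
      have h2 : f • w - (β c : Fin n → T) = f • (β c' : Fin n → T) := this
      rw [← h2]; abel
    · rintro ⟨w, hw⟩
      refine ⟨w, ?_⟩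
      have : φ w = β c := Subtype.ext hw.symm
      change red r (β.symm (φ w)) = _
      rw [this, LinearEquiv.symm_apply_apply]
  have hρs : Function.Surjective ρ := fun y => by
    obtain ⟨x, rfl⟩ := hπ y
    obtain ⟨w, rfl⟩ := hreds n x
    exact ⟨w, hρ w⟩
  let e : L ≃ₗ[T] (LinearMap.ker q).restrictScalars T :=
    (ρ.quotKerEquivOfSurjective hρs).symm ≪≫ₗ Submodule.quotEquivOfEq _ _ hlk.symm ≪≫ₗ
      lam.quotKerEquivRange ≪≫ₗ LinearEquiv.ofEq _ _ hlr
  refine ⟨r, q, hqs, ⟨LinearEquiv.symm { e with map_smul' := fun b x => ?_ }⟩⟩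
  obtain ⟨t, rfl⟩ := hsurj b
  have := e.map_smul t x
  rw [algebraMap_smul]
  refine this.trans (Subtype.ext ?_)
  exact (algebraMap_smul B t _).symm

end HypersurfaceSyzygy

/-! ### Descent from the completion -/

section Descent

open IsLocalRing

variable {R B : Type*} [CommRing R] [IsLocalRing R] [IsNoetherianRing R] [CommRing B]
  [IsLocalRing B] [IsNoetherianRing B] [Algebra R B] [Module.Flat R B]
  [IsLocalHom (algebraMap R B)]

-- As the residue fields agree, a generator of JB is congruent modulo m_B · JB to the image of some
-- a in J. By Nakayama a generates JB, and faithful flatness gives J = (a).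
omit [IsNoetherianRing R] in
lemma Ideal.isPrincipal_of_isPrincipal_map
    (hres : ∀ b : B, ∃ r : R, b - algebraMap R B r ∈ maximalIdeal B) (J : Ideal R)
    (hJ : (J.map (algebraMap R B)).IsPrincipal) : J.IsPrincipal := by
  have : Module.FaithfullyFlat R B := .of_flat_of_isLocalHom
  have key : ∀ y ∈ J.map (algebraMap R B), ∃ a ∈ J,
      y - algebraMap R B a ∈ maximalIdeal B • J.map (algebraMap R B) := by
    intro y hy
    refine Submodule.span_induction ?_ ⟨0, J.zero_mem, by simp⟩ ?_ ?_ hy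
    · rintro _ ⟨j, hj, rfl⟩
      exact ⟨j, hj, by simp⟩
    · rintro y z - - ⟨a, ha, hy⟩ ⟨c, hc, hz⟩
      refine ⟨a + c, J.add_mem ha hc, ?_⟩
      rw [map_add, add_sub_add_comm]
      exact add_mem hy hz
    · rintro b y hyJ ⟨a, ha, hy⟩
      obtain ⟨r, hr⟩ := hres b
      refine ⟨r * a, J.mul_mem_left r ha, ?_⟩
      have h1 : (b - algebraMap R B r) * y ∈ maximalIdeal B • J.map (algebraMap R B) :=
        Ideal.mul_mem_mul hr hyJ
      have h2 := Ideal.mul_mem_left _ (algebraMap R B r) hy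
      convert add_mem h1 h2 using 1
      rw [map_mul, smul_eq_mul]; ring
  obtain ⟨g, hg⟩ := hJ
  have hgJ : g ∈ J.map (algebraMap R B) := hg ▸ Submodule.mem_span_singleton_self g
  obtain ⟨a, ha, hga⟩ := key g hgJ
  have hle : J.map (algebraMap R B) ≤ Ideal.span {algebraMap R B a} := by
    refine Submodule.le_of_le_smul_of_le_jacobson_bot (I := maximalIdeal B)
      (IsNoetherian.noetherian _) (maximalIdeal_le_jacobson _) fun y hy => ?_
    obtain ⟨c, rfl⟩ := Submodule.mem_span_singleton.1 (hg ▸ hy)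
    rw [show c • g = c * algebraMap R B a + c * (g - algebraMap R B a) by
      rw [smul_eq_mul]; ring]
    exact Submodule.add_mem_sup (Ideal.mul_mem_left _ _ (Ideal.mem_span_singleton_self _))
      (Ideal.mul_mem_left _ c hga)
  refine ⟨⟨a, le_antisymm ?_ ((Ideal.span_singleton_le_iff_mem _).2 ha)⟩⟩
  rw [← Ideal.comap_map_eq_self_of_faithfullyFlat (B := B) J]
  refine (Ideal.comap_mono hle).trans ?_
  rw [← Set.image_singleton, ← Ideal.map_span, Ideal.comap_map_eq_self_of_faithfullyFlat]

variable {N N' : Type*} [AddCommGroup N] [Module R N] [Module.Finite R N]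
  [AddCommGroup N'] [Module R N'] [Module.Finite R N']

-- By flatness Hom commutes with base change, so e is a B-combination of maps defined over R.
-- Replacing the coefficients by elements of R with the same residues changes e only modulo m_B, and
-- Nakayama preserves surjectivity.
omit [IsNoetherianRing B] in
lemma exists_surjective_of_baseChange
    (hres : ∀ b : B, ∃ r : R, b - algebraMap R B r ∈ maximalIdeal B)
    (e : (B ⊗[R] N) →ₗ[B] (B ⊗[R] N')) (he : Function.Surjective e) :
    ∃ φ : N →ₗ[R] N', Function.Surjective φ := by
  have : Module.FaithfullyFlat R B := .of_flat_of_isLocalHom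
  have hN : Module.FinitePresentation R N := Module.finitePresentation_of_finite R N
  have hbc := Module.FinitePresentation.isBaseChange_map R N N' B
  have key : ∃ φ : N →ₗ[R] N', ∀ y, e y - φ.baseChange B y ∈
      maximalIdeal B • (⊤ : Submodule B (B ⊗[R] N')) := by
    clear he
    induction e using hbc.inductionOn with
    | zero => exact ⟨0, fun y => by simp⟩
    | tmul φ => exact ⟨φ, fun y => by simp⟩
    | smul b e he =>
      obtain ⟨φ, hφ⟩ := he
      obtain ⟨r, hr⟩ := hres b
      refine ⟨r • φ, fun y => ?_⟩
      have h1 := Submodule.smul_mem_smul (N := ⊤) hr (Submodule.mem_top (x := e y))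
      have h2 := Submodule.smul_mem _ (algebraMap R B r) (hφ y)
      convert add_mem h1 h2 using 1
      rw [LinearMap.baseChange_smul, LinearMap.smul_apply, LinearMap.smul_apply, sub_smul,
        smul_sub, algebraMap_smul, algebraMap_smul]
      abel
    | add e₁ e₂ h₁ h₂ =>
      obtain ⟨φ, hφ⟩ := h₁
      obtain ⟨ψ, hψ⟩ := h₂
      refine ⟨φ + ψ, fun y => ?_⟩
      rw [LinearMap.baseChange_add, LinearMap.add_apply, LinearMap.add_apply, add_sub_add_comm]
      exact add_mem (hφ y) (hψ y)
  obtain ⟨φ, hφ⟩ := key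
  refine ⟨φ, (Module.FaithfullyFlat.lTensor_surjective_iff_surjective R B φ).1 ?_⟩
  have hle : (⊤ : Submodule B (B ⊗[R] N')) ≤ LinearMap.range (φ.baseChange B) := by
    refine Submodule.le_of_le_smul_of_le_jacobson_bot (I := maximalIdeal B)
      (Module.finite_def.1 inferInstance) (maximalIdeal_le_jacobson _) fun y _ => ?_
    obtain ⟨x, rfl⟩ := he y
    rw [← add_sub_cancel (φ.baseChange B x) (e x)]
    exact Submodule.add_mem_sup (LinearMap.mem_range_self _ x) (hφ x)
  exact LinearMap.range_eq_top.1 (top_le_iff.1 hle)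

omit [IsNoetherianRing B] in
/-- Finite modules that become isomorphic over the completion are isomorphic. -/
lemma nonempty_linearEquiv_of_baseChange
    (hres : ∀ b : B, ∃ r : R, b - algebraMap R B r ∈ maximalIdeal B)
    (e : (B ⊗[R] N) ≃ₗ[B] (B ⊗[R] N')) : Nonempty (N ≃ₗ[R] N') := by
  obtain ⟨φ, hφ⟩ := exists_surjective_of_baseChange hres e.toLinearMap e.surjective
  obtain ⟨ψ, hψ⟩ := exists_surjective_of_baseChange hres e.symm.toLinearMap e.symm.surjective
  -- The maps φ and ψ need not be inverse to each other, but a surjective endomorphism of a finite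
  -- module is injective.
  have := OrzechProperty.injective_of_surjective_endomorphism (ψ ∘ₗ φ) (hψ.comp hφ)
  exact ⟨LinearEquiv.ofBijective φ ⟨Function.Injective.of_comp this, hφ⟩⟩

end Descent

/-! ### Structure and periodicity of one-dimensional hypersurfaces -/

section CompletedHypersurface

open IsLocalRing

variable {R B T : Type u} [CommRing R] [IsLocalRing R] [IsNoetherianRing R] [CommRing B]
  [IsLocalRing B] [IsNoetherianRing B] [Algebra R B] [Module.Flat R B]
  [IsLocalHom (algebraMap R B)] [CommRing T] [IsLocalRing T] [IsNoetherianRing T] [Algebra T B]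

omit [IsNoetherianRing R] [IsNoetherianRing B] [IsLocalRing B] [Module.Flat R B]
  [IsNoetherianRing T] in
/-- A regular element acting on a `B`-module detects elements killed by `(u, v)`. -/
lemma eq_zero_of_smul_eq_zero_of_isSMulRegular (hsurj : Function.Surjective (algebraMap T B))
    {u v : T} (hm : maximalIdeal T = Ideal.span {u, v}) {L : Type*} [AddCommGroup L] [Module B L]
    {x : R} (hx : x ∈ maximalIdeal R) (hL : IsSMulRegular L (algebraMap R B x)) {y : L}
    (hu : algebraMap T B u • y = 0) (hv : algebraMap T B v • y = 0) : y = 0 := by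
  obtain ⟨t, ht⟩ := hsurj (algebraMap R B x)
  have htm : t ∈ maximalIdeal T := by
    rw [mem_maximalIdeal, mem_nonunits_iff]
    intro h
    have := (ht ▸ h.map (algebraMap T B)).of_map (algebraMap R B) x
    exact (mem_maximalIdeal x).1 hx this
  obtain ⟨c, d, rfl⟩ := Ideal.mem_span_pair.1 (hm ▸ htm)
  refine hL (?_ : algebraMap R B x • y = algebraMap R B x • 0)
  rw [← ht, map_add, map_mul, map_mul, add_smul, mul_smul, mul_smul, hu, hv]
  simp

omit [IsNoetherianRing R] in
/-- Over a hypersurface of dimension one, ideals with torsion-free quotient are principal. -/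
lemma Ideal.isPrincipal_of_isSMulRegular_quotient
    (hres : ∀ b : B, ∃ r : R, b - algebraMap R B r ∈ maximalIdeal B)
    (hsurj : Function.Surjective (algebraMap T B))
    {u v : T} (hm : maximalIdeal T = Ideal.span {u, v})
    (hT : ∀ a b : T, u * a + v * b = 0 → ∃ c, a = v * c ∧ b = -(u * c))
    {x : R} (hx : x ∈ maximalIdeal R) (J : Ideal R) (hJ : IsSMulRegular (R ⧸ J) x) :
    J.IsPrincipal := by
  refine J.isPrincipal_of_isPrincipal_map hres ?_
  -- T/G ≅ B/JB has positive depth, so the preimage G of JB is a free ideal of T, hence principal.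
  set G := (J.map (algebraMap R B)).comap (algebraMap T B) with hG
  have hreg : IsSMulRegular (B ⧸ J.map (algebraMap R B)) (algebraMap R B x) := by
    have h1 := IsSMulRegular.of_flat_of_isBaseChange (TensorProduct.isBaseChange R (R ⧸ J) B) hJ
    have e := (Algebra.TensorProduct.quotIdealMapEquivTensorQuot B J).toLinearEquiv
    exact (e.isSMulRegular_congr _).2 h1
  have : Module.FinitePresentation T G := Module.finitePresentation_of_finite T G
  have hfree : Module.Free T G := by
    refine free_of_depth_two hm (fun a b h => hT a b h) G fun w hu hv => ?_
    rw [hG, Ideal.mem_comap, ← Ideal.Quotient.eq_zero_iff_mem]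
    refine eq_zero_of_smul_eq_zero_of_isSMulRegular (R := R) hsurj hm hx hreg ?_ ?_
    · rw [Algebra.smul_def, Ideal.Quotient.algebraMap_eq, ← map_mul, ← map_mul]
      exact Ideal.Quotient.eq_zero_iff_mem.2 hu
    · rw [Algebra.smul_def, Ideal.Quotient.algebraMap_eq, ← map_mul, ← map_mul]
      exact Ideal.Quotient.eq_zero_iff_mem.2 hv
  obtain ⟨g, hg⟩ := Ideal.isPrincipal_of_free G
  rw [← Ideal.map_comap_of_surjective _ hsurj (J.map (algebraMap R B)), ← hG, hg]
  refine ⟨⟨algebraMap T B g, ?_⟩⟩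
  change Ideal.map _ (Ideal.span {g}) = Ideal.span _
  rw [Ideal.map_span, Set.image_singleton]

omit [IsNoetherianRing R] [IsNoetherianRing B] [IsNoetherianRing T] in
/-- A hypersurface of dimension one has positive depth. -/
lemma eq_zero_of_maximalIdeal_mul_eq_zero
    (hmB : maximalIdeal B = (maximalIdeal R).map (algebraMap R B))
    (hsurj : Function.Surjective (algebraMap T B)) {f : T}
    (hker : RingHom.ker (algebraMap T B) = Ideal.span {f}) (hf : f ∈ nonZeroDivisors T)
    {u v : T} (hm : maximalIdeal T = Ideal.span {u, v}) (hu : u ∈ nonZeroDivisors T)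
    (hT : ∀ a b : T, u * a + v * b = 0 → ∃ c, a = v * c ∧ b = -(u * c))
    (z : R) (hz : ∀ x ∈ maximalIdeal R, x * z = 0) : z = 0 := by
  have : Module.FaithfullyFlat R B := .of_flat_of_isLocalHom
  have hzB : ∀ y ∈ maximalIdeal B, y * algebraMap R B z = 0 := by
    intro y hy
    rw [hmB] at hy
    refine Submodule.span_induction ?_ (by simp) ?_ ?_ hy
    · rintro _ ⟨x, hx, rfl⟩
      rw [← map_mul, hz x hx, map_zero]
    · intro a b _ _ ha hb; rw [add_mul, ha, hb, add_zero]
    · intro a b _ hb; rw [smul_eq_mul, mul_assoc, hb, mul_zero]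
  have hloc : ∀ t ∈ maximalIdeal T, algebraMap T B t ∈ maximalIdeal B := by
    have := IsLocalHom.of_surjective (algebraMap T B) hsurj
    have hle : (maximalIdeal T).map (algebraMap T B) ≤ maximalIdeal B :=
      ((local_hom_TFAE (algebraMap T B)).out 0 2).1 this
    exact fun t ht => hle (Ideal.mem_map_of_mem _ ht)
  obtain ⟨t, ht⟩ := hsurj (algebraMap R B z)
  have hmem (s : T) (hs : s ∈ maximalIdeal T) : ∃ a, s * t = f * a := by
    have : s * t ∈ RingHom.ker (algebraMap T B) := by
      rw [RingHom.mem_ker, map_mul, ht, hzB _ (hloc s hs)]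
    rw [hker, Ideal.mem_span_singleton] at this
    exact this
  obtain ⟨a, ha⟩ := hmem u (hm ▸ Ideal.subset_span (by simp))
  obtain ⟨b, hb⟩ := hmem v (hm ▸ Ideal.subset_span (by simp))
  -- Computing uvt in two ways from ut = fa and vt = fb and cancelling f gives a Koszul relation. It
  -- yields a = uc, hence t = fc, so z becomes zero in B.
  have h0 : u * b + v * (-a) = 0 := by
    refine (mul_left_mem_nonZeroDivisors_eq_zero_iff hf).1 ?_
    linear_combination v * ha - u * hb
  obtain ⟨c, -, hc⟩ := hT _ _ h0
  have htc : t = f * c := by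
    refine (mul_cancel_left_mem_nonZeroDivisors hu).1 ?_
    linear_combination ha - f * hc
  refine FaithfulSMul.algebraMap_injective R B ?_
  rw [map_zero, ← ht, ← RingHom.mem_ker, hker, Ideal.mem_span_singleton]
  exact ⟨c, htc⟩

omit [IsNoetherianRing B] in
/-- Over a hypersurface of dimension one, `Tor` with a torsion-free module is `2`-periodic. -/
lemma torLength_add_two_of_isSMulRegular
    (hres : ∀ b : B, ∃ r : R, b - algebraMap R B r ∈ maximalIdeal B)
    (hsurj : Function.Surjective (algebraMap T B)) {f : T}
    (hker : RingHom.ker (algebraMap T B) = Ideal.span {f}) (hf : f ∈ nonZeroDivisors T)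
    {u v : T} (hm : maximalIdeal T = Ideal.span {u, v})
    (hT : ∀ a b : T, u * a + v * b = 0 → ∃ c, a = v * c ∧ b = -(u * c))
    {x : R} (hx : x ∈ maximalIdeal R) (M N : Type u) [AddCommGroup M] [Module R M]
    [AddCommGroup N] [Module R N] [Module.Finite R N] (hN : IsSMulRegular N x) (i : ℕ) :
    torLength R M N (i + 4) = torLength R M N (i + 2) := by
  classical
  obtain ⟨n, p, hp⟩ := Module.Finite.exists_fin' R N
  obtain ⟨m, q, hq⟩ := Module.Finite.exists_fin' R (LinearMap.ker p)
  let eB (k : ℕ) : (B ⊗[R] (Fin k → R)) ≃ₗ[B] (Fin k → B) :=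
    TensorProduct.piScalarRight R B B (Fin k)
  let π : (Fin n → B) →ₗ[B] B ⊗[R] N := p.baseChange B ∘ₗ (eB n).symm.toLinearMap
  have hπ : Function.Surjective π := (LinearMap.baseChange_surjective B hp).comp (eB n).symm.surjective
  let ρ : (Fin n → T) →ₗ[T] B ⊗[R] N := π.restrictScalars T ∘ₗ
    LinearMap.pi fun i => Algebra.linearMap T B ∘ₗ LinearMap.proj i
  have hreg := IsSMulRegular.of_flat_of_isBaseChange (TensorProduct.isBaseChange R N B) hN
  have : Module.FinitePresentation T (LinearMap.ker ρ) := Module.finitePresentation_of_finite T _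
  have hfree : Module.Free T (LinearMap.ker ρ) := by
    refine free_of_depth_two hm (fun a b h => ?_) _ fun w hu hv => ?_
    · choose c hc hc' using fun i => hT (a i) (b i) (congrFun h i)
      exact ⟨c, funext hc, funext hc'⟩
    · refine eq_zero_of_smul_eq_zero_of_isSMulRegular (R := R) hsurj hm hx hreg ?_ ?_
      · rw [algebraMap_smul, ← map_smul]; exact hu
      · rw [algebraMap_smul, ← map_smul]; exact hv
  obtain ⟨r, g, hg, ⟨e⟩⟩ := exists_periodic_presentation hsurj hker hf π hπ ρ (fun w => rfl)
  let e₁ : B ⊗[R] LinearMap.ker p ≃ₗ[B] LinearMap.ker π :=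
    (LinearMap.tensorKerEquiv B B p).trans
      { toFun := fun y => ⟨eB n y, by
          change p.baseChange B ((eB n).symm (eB n y)) = 0
          rw [LinearEquiv.symm_apply_apply]
          exact y.2⟩
        invFun := fun y => ⟨(eB n).symm y, y.2⟩
        map_add' := fun _ _ => Subtype.ext (map_add _ _ _)
        map_smul' := fun _ _ => Subtype.ext (map_smul _ _ _)
        left_inv := fun y => Subtype.ext ((eB n).symm_apply_apply _)
        right_inv := fun y => Subtype.ext ((eB n).apply_symm_apply _) }
  let g' : (Fin r → B) →ₗ[B] B ⊗[R] LinearMap.ker p := e₁.symm.toLinearMap ∘ₗ g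
  have hgk : LinearMap.ker g' = LinearMap.ker g := LinearEquiv.ker_comp _ _
  obtain ⟨s⟩ := schanuel (p := q.baseChange B) (q := g') (LinearMap.baseChange_surjective B hq)
    (e₁.symm.surjective.comp hg)
  -- Over B, the base change of ker q and the module B ⊗ N are both kernels of free covers of the
  -- same first syzygy. Schanuel makes them isomorphic after adding free summands, whose ranks r and
  -- m may differ.
  let e₂ : B ⊗[R] (LinearMap.ker q × (Fin r → R)) ≃ₗ[B] B ⊗[R] (N × (Fin m → R)) :=
    TensorProduct.prodRight R B B _ _ ≪≫ₗ
      (LinearEquiv.prodCongr (LinearMap.tensorKerEquiv B B q) (eB r)) ≪≫ₗ s ≪≫ₗ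
      (LinearEquiv.prodCongr (LinearEquiv.ofEq _ _ hgk ≪≫ₗ e) (LinearEquiv.refl B _)) ≪≫ₗ
      (TensorProduct.prodRight R B B _ _).symm
  obtain ⟨e₃⟩ := nonempty_linearEquiv_of_baseChange hres e₂
  calc torLength R M N (i + 4) = torLength R M (LinearMap.ker p) (i + 3) :=
        torLength_succ_succ (K := LinearMap.ker p) (F := Fin n → R) M
          (f := (LinearMap.ker p).subtype) (g := p) Subtype.val_injective
          (LinearMap.exact_subtype_ker_map p) hp (i + 2)
    _ = torLength R M (LinearMap.ker q) (i + 2) :=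
        torLength_succ_succ (K := LinearMap.ker q) (F := Fin m → R) M
          (f := (LinearMap.ker q).subtype) (g := q) Subtype.val_injective
          (LinearMap.exact_subtype_ker_map q) hq (i + 1)
    _ = torLength R M (LinearMap.ker q × (Fin r → R)) (i + 2) :=
        (torLength_prod_projective M _ _ i).symm
    _ = torLength R M (N × (Fin m → R)) (i + 2) := torLength_congr_right M e₃ _
    _ = torLength R M N (i + 2) := torLength_prod_projective M _ _ i

end CompletedHypersurface

section HypersurfaceStructure

open IsLocalRing

variable {R : Type u} [CommRing R] [IsLocalRing R] [IsNoetherianRing R]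

/-- A Noetherian local ring of positive depth has a regular element in its maximal ideal. -/
lemma exists_mem_maximalIdeal_isSMulRegular
    (h : ∀ z : R, (∀ x ∈ maximalIdeal R, x * z = 0) → z = 0) :
    ∃ x ∈ maximalIdeal R, IsSMulRegular R x := by
  by_contra! hcon
  have hsub : (maximalIdeal R : Set R) ⊆ ⋃ p ∈ associatedPrimes R R, (p : Set R) := by
    intro x hx
    rw [biUnion_associatedPrimes_eq_compl_nonZeroDivisors]
    intro hx'
    refine hcon x hx fun a b hab => (mul_cancel_left_mem_nonZeroDivisors hx').1 hab
  obtain ⟨P, hP, hle⟩ := (Ideal.subset_union_prime_finite (associatedPrimes.finite R R)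
    (f := id) ⊥ ⊥ fun _ h _ _ => h.isPrime).1 hsub
  obtain ⟨z, hz⟩ := ((isAssociatedPrime_iff_exists_injective_linearMap P R).1 hP).2
  have hz0 : ∀ x ∈ maximalIdeal R, x * z 1 = 0 := by
    intro x hx
    rw [← smul_eq_mul, ← map_smul]
    have : x • (1 : R ⧸ P) = 0 := by
      rw [Algebra.smul_def, mul_one]
      exact Ideal.Quotient.eq_zero_iff_mem.2 (hle hx)
    rw [this, map_zero]
  have := hz (((h _ hz0).trans (map_zero z).symm))
  have hPp := hP.isPrime
  exact one_ne_zero this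

/-- The structure of a hypersurface of dimension one with principal maximal ideal. -/
lemma structure_of_maximalIdeal_isPrincipal (hdim : ringKrullDim R = 1)
    (hm : (maximalIdeal R).IsPrincipal) :
    ∃ x ∈ maximalIdeal R, IsSMulRegular R x ∧
      (∀ J : Ideal R, IsSMulRegular (R ⧸ J) x → J.IsPrincipal) ∧
      (∀ (M N : Type u) [AddCommGroup M] [Module R M] [AddCommGroup N] [Module R N]
        [Module.Finite R N], IsSMulRegular N x →
        ∀ i, torLength R M N (i + 4) = torLength R M N (i + 2)) := by
  obtain ⟨y, hy⟩ := hm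
  -- Dimension one provides a non-maximal prime, which must be zero because the maximal ideal is
  -- principal; so R is a domain.
  have hne : ∃ q : PrimeSpectrum R, q.asIdeal ≠ maximalIdeal R := by
    obtain ⟨l, hl⟩ := Order.le_krullDim_iff.1 (show ((1 : ℕ) : WithBot ℕ∞) ≤ _ from hdim.ge)
    have h01 : (l ⟨0, by omega⟩).asIdeal < (l ⟨1, by omega⟩).asIdeal :=
      l.strictMono (Fin.mk_lt_mk.2 (by simp))
    exact ⟨_, (h01.trans_le (le_maximalIdeal (l ⟨1, by omega⟩).2.ne_top)).ne⟩
  obtain ⟨q, hq⟩ := hne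
  have hq0 := q.2.eq_bot_of_maximalIdeal_eq_span_singleton hy hq
  have : (⊥ : Ideal R).IsPrime := hq0 ▸ q.2
  have : IsDomain R := IsDomain.of_bot_isPrime R
  have htfae : IsPrincipalIdealRing R ↔ (maximalIdeal R).IsPrincipal :=
    (tfae_of_isNoetherianRing_of_isLocalRing_of_isDomain R).out 0 4
  have : IsPrincipalIdealRing R := htfae.2 ⟨y, hy⟩
  have hy0 : y ≠ 0 := by
    rintro rfl
    rw [hq0] at hq
    exact hq (by rw [hy]; simp)
  refine ⟨y, hy ▸ Ideal.mem_span_singleton_self y, fun a b h => mul_left_cancel₀ hy0 h,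
    fun J _ => inferInstance, fun M N _ _ _ _ _ hN i => ?_⟩
  have := Module.finitePresentation_of_finite R N
  have := free_of_maximalIdeal_eq_span_singleton hy N hN
  rw [torLength_of_projective, torLength_of_projective]

/-- The maximal ideal of R is minimal over some (y). A prime of B containing y contracts to a prime
containing y, hence to the maximal ideal, so it contains m_R B = m_B. Krull's theorem then bounds
the height of m_B. -/
lemma ringKrullDim_le_one_of_maximalIdeal_eq_map (hdim : ringKrullDim R = 1) {B : Type*}
    [CommRing B] [IsLocalRing B] [IsNoetherianRing B] [Algebra R B]
    (hmB : maximalIdeal B = (maximalIdeal R).map (algebraMap R B)) : ringKrullDim B ≤ 1 := by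
  obtain ⟨s, hs, hcard⟩ := Ideal.exists_finset_card_eq_height_of_isNoetherianRing (maximalIdeal R)
  have h1 : (maximalIdeal R).height = 1 := by
    have := maximalIdeal_height_eq_ringKrullDim (R := R)
    rw [hdim] at this
    exact_mod_cast this
  rw [h1] at hcard
  obtain ⟨y, rfl⟩ := Finset.card_eq_one.1 (by exact_mod_cast hcard : s.card = 1)
  rw [Finset.coe_singleton] at hs
  have hmin : maximalIdeal B ∈ (Ideal.span {algebraMap R B y}).minimalPrimes := by
    refine ⟨⟨inferInstance, ?_⟩, fun Q hQ _ => ?_⟩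
    · rw [Ideal.span_singleton_le_iff_mem, hmB]
      exact Ideal.mem_map_of_mem _ (hs.1.2 (Ideal.mem_span_singleton_self y))
    · rw [hmB, Ideal.map_le_iff_le_comap]
      have := hQ.1
      refine hs.2 ⟨inferInstance, ?_⟩ (le_maximalIdeal (Ideal.IsPrime.ne_top inferInstance))
      rw [Ideal.span_singleton_le_iff_mem, Ideal.mem_comap]
      exact hQ.2 (Ideal.mem_span_singleton_self _)
  have := Ideal.height_le_one_of_isPrincipal_of_mem_minimalPrimes _ _ hmin
  rw [← maximalIdeal_height_eq_ringKrullDim]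
  exact_mod_cast this

/-- The consequences of the hypersurface hypothesis that are used for `θ`. -/
theorem IsHypersurface.exists_isSMulRegular (hR : IsHypersurface R) (hdim : ringKrullDim R = 1) :
    ∃ x ∈ maximalIdeal R, IsSMulRegular R x ∧
      (∀ J : Ideal R, IsSMulRegular (R ⧸ J) x → J.IsPrincipal) ∧
      (∀ (M N : Type u) [AddCommGroup M] [Module R M] [AddCommGroup N] [Module R N]
        [Module.Finite R N], IsSMulRegular N x →
        ∀ i, torLength R M N (i + 4) = torLength R M N (i + 2)) := by
  obtain ⟨T, _, _, f, hfm, ⟨e⟩⟩ := hR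
  let B := AdicCompletion (maximalIdeal R) R
  have hmB : maximalIdeal B = (maximalIdeal R).map (algebraMap R B) :=
    AdicCompletion.maximalIdeal_eq_map
  have : IsNoetherianRing B := isNoetherianRing_of_ringEquiv _ e.symm
  have hres : ∀ b : B, ∃ r : R, b - algebraMap R B r ∈ maximalIdeal B := by
    intro b
    obtain ⟨c, hc⟩ := (AdicCompletion.residueField_map_bijective R).2 (residue B b)
    obtain ⟨r, rfl⟩ := residue_surjective c
    rw [ResidueField.map_residue] at hc
    exact ⟨r, Ideal.Quotient.eq.1 hc.symm⟩
  algebraize [e.symm.toRingHom.comp (Ideal.Quotient.mk (Ideal.span {f}))]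
  have hsurj : Function.Surjective (algebraMap T B) :=
    e.symm.surjective.comp Ideal.Quotient.mk_surjective
  have hker : RingHom.ker (algebraMap T B) = Ideal.span {f} := by
    ext t
    change e.symm (Ideal.Quotient.mk _ t) = 0 ↔ _
    rw [EmbeddingLike.map_eq_zero_iff, Ideal.Quotient.eq_zero_iff_mem]
  have hdB : ringKrullDim B ≤ 1 := ringKrullDim_le_one_of_maximalIdeal_eq_map hdim hmB
  have hdT : ringKrullDim T ≤ 2 := by
    have := Ideal.height_le_ringKrullDim_quotient_add_one hfm
    rw [maximalIdeal_height_eq_ringKrullDim, ← ringKrullDim_eq_of_ringEquiv e] at this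
    exact this.trans ((add_le_add_left hdB 1).trans (by norm_num))
  have hspan := IsRegularLocalRing.spanFinrank_maximalIdeal (R := T)
  have hfg : (maximalIdeal T).FG := IsNoetherian.noetherian _
  obtain ⟨s, hs, hsp⟩ := Submodule.FG.exists_span_set_encard_eq_spanFinrank hfg
  have hle2 : (maximalIdeal T).spanFinrank ≤ 2 := by
    rw [← hspan] at hdT
    exact_mod_cast hdT
  -- If T needs fewer than two generators for its maximal ideal, the maximal ideals of B and R are
  -- principal as well. In this case f may be zero, so the matrix factorization argument is
  -- unavailable.
  by_cases h2 : (maximalIdeal T).spanFinrank = 2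
  · rw [h2] at hs hspan
    obtain ⟨u, v, huv, rfl⟩ := Set.encard_eq_two.1 hs
    have hm : maximalIdeal T = Ideal.span {u, v} := hsp.symm
    obtain ⟨hdom, hu0, hup, hv⟩ := isDomain_of_maximalIdeal_eq_span_pair hm (by rw [← hspan]; rfl)
    have hT := exists_of_mul_add_mul_eq_zero hu0 hup hv
    -- For f = 0 the completion would be T itself, of dimension two.
    have hf : f ≠ 0 := by
      rintro rfl
      have e' : B ≃+* T := e.trans ((Ideal.quotEquivOfEq (by simp)).trans (RingEquiv.quotientBot T))
      rw [ringKrullDim_eq_of_ringEquiv e', ← hspan] at hdB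
      norm_num at hdB
    have hf' := mem_nonZeroDivisors_of_ne_zero hf
    obtain ⟨x, hx, hxr⟩ := exists_mem_maximalIdeal_isSMulRegular (R := R)
      (eq_zero_of_maximalIdeal_mul_eq_zero hmB hsurj hker hf' hm
        (mem_nonZeroDivisors_of_ne_zero hu0) hT)
    exact ⟨x, hx, hxr, fun J hJ => J.isPrincipal_of_isSMulRegular_quotient hres hsurj hm hT hx hJ,
      fun M N _ _ _ _ _ hN i =>
        torLength_add_two_of_isSMulRegular hres hsurj hker hf' hm hT hx M N hN i⟩
  · refine structure_of_maximalIdeal_isPrincipal hdim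
      (Ideal.isPrincipal_of_isPrincipal_map hres _ ?_)
    have hT : ∃ w, maximalIdeal T = Ideal.span {w} := by
      have : s.encard ≤ 1 := by
        rw [hs]
        exact_mod_cast (by omega : (maximalIdeal T).spanFinrank ≤ 1)
      rcases Set.encard_le_one_iff_eq.1 this with rfl | ⟨w, rfl⟩
      · exact ⟨0, by rw [← hsp]; simp⟩
      · exact ⟨w, hsp.symm⟩
    obtain ⟨w, hw⟩ := hT
    have hloc := IsLocalHom.of_surjective (algebraMap T B) hsurj
    have hcomap : (maximalIdeal B).comap (algebraMap T B) = maximalIdeal T :=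
      ((local_hom_TFAE (algebraMap T B)).out 0 4).1 hloc
    refine ⟨⟨algebraMap T B w, ?_⟩⟩
    change _ = Ideal.span _
    rw [← hmB, ← Ideal.map_comap_of_surjective _ hsurj (maximalIdeal B), hcomap, hw, Ideal.map_span,
      Set.image_singleton]

end HypersurfaceStructure

/-! ### Finite length of Tor over an isolated singularity -/

section IsolatedSingularity

open IsLocalRing

variable {R : Type u} [CommRing R]

/-- Injections of finite modules split up to a multiplier, locally at a reduced minimal prime. -/
lemma exists_comp_eq_smul_id [IsNoetherianRing R] (p : Ideal R) [p.IsPrime]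
    (hp : IsField (Localization.AtPrime p)) {K F : Type*} [AddCommGroup K] [Module R K]
    [Module.Finite R K] [AddCommGroup F] [Module R F] [Module.Finite R F] {ι : K →ₗ[R] F}
    (hι : Function.Injective ι) :
    ∃ (ρ : F →ₗ[R] K) (s : R), s ∉ p ∧ ρ ∘ₗ ι = s • LinearMap.id := by
  have : Module.FinitePresentation R F := Module.finitePresentation_of_finite R F
  let S := p.primeCompl
  let ιp := LocalizedModule.map S ι
  have hιp : Function.Injective ιp := LocalizedModule.map_injective S ι hι
  obtain ⟨r, hr⟩ : ∃ r : LocalizedModule S F →ₗ[Localization.AtPrime p] LocalizedModule S K,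
      r ∘ₗ ιp = LinearMap.id := by
    let := hp.toField
    exact LinearMap.exists_leftInverse_of_injective ιp (LinearMap.ker_eq_bot.2 hιp)
  obtain ⟨ρ, s, hs⟩ := Module.FinitePresentation.exists_lift_of_isLocalizedModule S
    (LocalizedModule.mkLinearMap S K) (r.restrictScalars R ∘ₗ LocalizedModule.mkLinearMap S F)
  -- ρ ∘ ι and multiplication by s agree after localization; as K is finite, a single multiplier s'
  -- makes them agree over R.
  obtain ⟨s', hs'⟩ := Module.Finite.exists_smul_of_comp_eq_of_isLocalizedModule S
    (LocalizedModule.mkLinearMap S K) (ρ ∘ₗ ι) (s • LinearMap.id) (by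
      ext k
      have h1 := LinearMap.congr_fun hs (ι k)
      have h2 := LinearMap.congr_fun hr (LocalizedModule.mkLinearMap S K k)
      have h3 : ιp (LocalizedModule.mkLinearMap S K k) = LocalizedModule.mkLinearMap S F (ι k) := by
        simp [ιp]
      rw [LinearMap.comp_apply, h3] at h2
      exact (h1.trans (congrArg (s • ·) h2)).trans
        ((LocalizedModule.mkLinearMap S K).map_smul_of_tower s k).symm)
  refine ⟨s' • ρ, s' * s, (s' * s).2, ?_⟩
  rw [LinearMap.smul_comp, hs', mul_smul]
  rfl

/-- A finite module that is locally killed outside the closed point has finite length. -/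
lemma length_ne_top_of_exists_smul_eq_zero [IsNoetherianRing R] [IsLocalRing R] {L : Type*}
    [AddCommGroup L] [Module R L] [Module.Finite R L]
    (h : ∀ p : Ideal R, p.IsPrime → p ≠ maximalIdeal R → ∃ s ∉ p, ∀ x : L, s • x = 0) :
    Module.length R L ≠ ⊤ := by
  let I := Module.annihilator R L
  let : Module (R ⧸ I) L := Module.quotientAnnihilator
  have : IsScalarTower R (R ⧸ I) L := inferInstance
  rw [Module.length_eq_of_surjective (S := R) (R := R ⧸ I) (M := L) Ideal.Quotient.mk_surjective]
  -- The hypothesis says that only the maximal ideal contains the annihilator of L.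
  have hA : IsArtinianRing (R ⧸ I) := by
    rw [isArtinianRing_iff_krullDimLE_zero, Ring.krullDimLE_zero_iff]
    intro Q hQ
    have hc : (Q.comap (Ideal.Quotient.mk I)).IsPrime := inferInstance
    have : Q.comap (Ideal.Quotient.mk I) = maximalIdeal R := by
      by_contra hne
      obtain ⟨s, hs, hs0⟩ := h _ hc hne
      refine hs ?_
      rw [Ideal.mem_comap, Ideal.Quotient.eq_zero_iff_mem.2 (Module.mem_annihilator.2 hs0)]
      exact Q.zero_mem
    have hmax : (Q.comap (Ideal.Quotient.mk I)).IsMaximal := this ▸ inferInstance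
    have hor := Ideal.map_eq_top_or_isMaximal_of_surjective (Ideal.Quotient.mk I)
      Ideal.Quotient.mk_surjective hmax
    rw [Ideal.map_comap_of_surjective _ Ideal.Quotient.mk_surjective] at hor
    exact hor.resolve_left hQ.ne_top
  have : Module.Finite (R ⧸ I) L := Module.Finite.of_restrictScalars_finite R _ _
  exact Module.length_ne_top

variable [IsLocalRing R] [IsNoetherianRing R]

lemma HasIsolatedSingularity.isField (hsing : HasIsolatedSingularity R)
    (hdim : ringKrullDim R = 1) (p : Ideal R) [p.IsPrime] (hp : p ≠ maximalIdeal R) :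
    IsField (Localization.AtPrime p) := by
  have := hsing p hp
  have h0 : p.height = 0 := by
    have hlt := Ideal.height_strict_mono_of_isPrime (lt_of_le_of_ne (le_maximalIdeal
      (Ideal.IsPrime.ne_top inferInstance)) hp)
    have h1 := maximalIdeal_height_eq_ringKrullDim (R := R)
    rw [hdim] at h1
    have h1 : (maximalIdeal R).height = 1 := by exact_mod_cast h1
    rw [h1] at hlt
    exact Order.lt_one_iff.1 hlt
  have hd : ringKrullDim (Localization.AtPrime p) = 0 := by
    rw [IsLocalization.AtPrime.ringKrullDim_eq_height p, h0]; rfl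
  have hs := IsRegularLocalRing.spanFinrank_maximalIdeal (R := Localization.AtPrime p)
  rw [hd] at hs
  have hs : (maximalIdeal (Localization.AtPrime p)).spanFinrank = 0 := by exact_mod_cast hs
  rw [Submodule.spanFinrank_eq_zero_iff_eq_bot (IsNoetherian.noetherian _)] at hs
  exact isField_iff_maximalIdeal_eq.2 hs

/-- Higher `Tor` modules over an isolated singularity of dimension one have finite length. -/
lemma torLength_ne_top_of_isField
    (hfld : ∀ (p : Ideal R) [p.IsPrime], p ≠ maximalIdeal R → IsField (Localization.AtPrime p))
    (M : Type u) [AddCommGroup M] [Module R M] [Module.Finite R M] (n : ℕ) :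
    ∀ (N : Type u) [AddCommGroup N] [Module R N] [Module.Finite R N],
      torLength R M N (n + 1) ≠ ⊤ := by
  induction n with
  | zero =>
    intro N _ _ _
    obtain ⟨n, p, hp⟩ := Module.Finite.exists_fin' R N
    rw [torLength_one (K := LinearMap.ker p) (F := Fin n → R) M
          (f := (LinearMap.ker p).subtype) (g := p) Subtype.val_injective
          (LinearMap.exact_subtype_ker_map p) hp]
    refine length_ne_top_of_exists_smul_eq_zero fun q hq hqm => ?_
    -- A retraction up to the factor s survives tensoring with M, so s kills the kernel of M ⊗ ker p
    -- → M ⊗ R^n.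
    obtain ⟨ρ, s, hs, hρ⟩ := exists_comp_eq_smul_id q (hfld q hqm) (LinearMap.ker p).injective_subtype
    refine ⟨s, hs, fun x => Subtype.ext ?_⟩
    have h1 := LinearMap.congr_fun (LinearMap.lTensor_comp M ρ (LinearMap.ker p).subtype) x.1
    rw [hρ, LinearMap.comp_apply, LinearMap.mem_ker.1 x.2, map_zero, LinearMap.lTensor_smul,
      LinearMap.lTensor_id] at h1
    exact h1
  | succ n ih =>
    intro N _ _ _
    obtain ⟨k, p, hp⟩ := Module.Finite.exists_fin' R N
    rw [torLength_succ_succ (K := LinearMap.ker p) (F := Fin k → R) M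
          (f := (LinearMap.ker p).subtype) (g := p) Subtype.val_injective
          (LinearMap.exact_subtype_ker_map p) hp]
    exact ih _

omit [IsLocalRing R] in
/-- Periodicity for torsion-free modules gives eventual periodicity for all finite modules. -/
lemma torLength_add_two_of_forall_isSMulRegular {x : R} (hx : IsSMulRegular R x) {n₀ : ℕ}
    (h : ∀ (M N : Type u) [AddCommGroup M] [Module R M] [AddCommGroup N] [Module R N]
        [Module.Finite R N], IsSMulRegular N x →
        ∀ i, torLength R M N (i + n₀ + 3) = torLength R M N (i + n₀ + 1))
    (M N : Type u) [AddCommGroup M] [Module R M] [AddCommGroup N] [Module R N]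
    [Module.Finite R N] (n : ℕ) (hn : n₀ + 2 ≤ n) :
    torLength R M N (n + 2) = torLength R M N n := by
  obtain ⟨k, p, hp⟩ := Module.Finite.exists_fin' R N
  obtain ⟨i, rfl⟩ := Nat.exists_eq_add_of_le hn
  have key := torLength_succ_succ (K := LinearMap.ker p) (F := Fin k → R) M
          (f := (LinearMap.ker p).subtype) (g := p) Subtype.val_injective
          (LinearMap.exact_subtype_ker_map p) hp
  rw [show n₀ + 2 + i + 2 = (i + n₀ + 2) + 2 by ring, show n₀ + 2 + i = (i + n₀) + 2 by ring,
    key, key]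
  refine h M _ (fun a b hab => Subtype.ext (funext fun j => hx ?_)) i
  exact congrFun (congrArg Subtype.val hab) j

end IsolatedSingularity

/-! ### Independence of θ from e -/

section ThetaDefined

variable {R : Type u} [CommRing R]

lemma hochsterThetaAt_succ_of_periodic {M N : Type u} [AddCommGroup M] [Module R M]
    [AddCommGroup N] [Module R N] {n₀ e : ℕ}
    (h : ∀ n, n₀ ≤ n → torLength R M N (n + 2) = torLength R M N n) (he : n₀ ≤ 2 * e + 1) :
    hochsterThetaAt R M N (e + 1) = hochsterThetaAt R M N e := by
  unfold hochsterThetaAt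
  have h1 := h (2 * e + 1) he
  have h2 := h (2 * e + 2) (by omega)
  rw [show 2 * (e + 1) + 2 = 2 * e + 2 + 2 by ring, show 2 * (e + 1) + 1 = 2 * e + 1 + 2 by ring,
    h1, h2]

lemma krullDimNat_eq_one (hdim : ringKrullDim R = 1) : krullDimNat R = 1 := by
  rw [krullDimNat, hdim]; rfl

lemma hochsterThetaDefined_of_periodic (hdim : ringKrullDim R = 1) {M N : Type u}
    [AddCommGroup M] [Module R M] [AddCommGroup N] [Module R N]
    (hfin : ∀ n, torLength R M N (n + 1) ≠ ⊤)
    (h : ∀ n, 3 ≤ n → torLength R M N (n + 2) = torLength R M N n) :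
    HochsterThetaDefined R M N := by
  intro e he
  rw [krullDimNat_eq_one hdim] at he
  refine ⟨hfin _, hfin _, ?_⟩
  rw [hochsterTheta, krullDimNat_eq_one hdim]
  -- For d = 1 the condition 3 ≤ 2e means e ≥ 2, and the reference value of θ is taken at e = d + 1
  -- = 2.
  obtain ⟨k, rfl⟩ := Nat.exists_eq_add_of_le (show 2 ≤ e by omega)
  clear he
  induction k with
  | zero => rfl
  | succ k ih =>
    rw [← ih]
    exact hochsterThetaAt_succ_of_periodic (n₀ := 3) (e := 2 + k) h (by omega)

end ThetaDefined

/-! ### Non-maximal primes and positivity of θ -/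

section MinimalPrimes

open IsLocalRing

variable {R : Type u} [CommRing R]

/-- Since N is the resolved variable, vanishing for flat M is a separate statement. It is what gives
θ(R, N) = 0. -/
lemma torLength_of_flat (M : Type u) [AddCommGroup M] [Module R M] [Module.Flat R M] (n : ℕ) :
    ∀ (N : Type u) [AddCommGroup N] [Module R N], torLength R M N (n + 1) = 0 := by
  induction n with
  | zero =>
    intro N _ _
    let p := Finsupp.linearCombination R (id : N → N)
    have hp : Function.Surjective p := Finsupp.linearCombination_id_surjective R N
    rw [torLength_one (K := LinearMap.ker p) (F := N →₀ R) M
          (f := (LinearMap.ker p).subtype) (g := p) Subtype.val_injective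
          (LinearMap.exact_subtype_ker_map p) hp, LinearMap.ker_eq_bot.2
          (Module.Flat.lTensor_preserves_injective_linearMap (M := M) (LinearMap.ker p).subtype
            Subtype.val_injective),
          Module.length_bot]
  | succ n ih =>
    intro N _ _
    let p := Finsupp.linearCombination R (id : N → N)
    have hp : Function.Surjective p := Finsupp.linearCombination_id_surjective R N
    rw [torLength_succ_succ (K := LinearMap.ker p) (F := N →₀ R) M
          (f := (LinearMap.ker p).subtype) (g := p) Subtype.val_injective
          (LinearMap.exact_subtype_ker_map p) hp]
    exact ih _

/-- For `a, b` with `Ann b = (a)`, the map `R / (a) → R` given by multiplication by `b`. -/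
def quotSpanMul {a b : R} (hab : b * a = 0) : (R ⧸ Ideal.span {a}) →ₗ[R] R :=
  Submodule.liftQ _ (LinearMap.mulLeft R b) (by
    rw [Ideal.span, Submodule.span_singleton_le_iff_mem]
    exact hab)

lemma quotSpanMul_mk {a b : R} (hab : b * a = 0) (c : R) :
    quotSpanMul hab (Ideal.Quotient.mk _ c) = b * c := rfl

lemma quotSpanMul_injective {a b : R} (hab : b * a = 0) (h : ∀ c, b * c = 0 → a ∣ c) :
    Function.Injective (quotSpanMul hab) := by
  rw [injective_iff_map_eq_zero]
  intro y hy
  obtain ⟨c, rfl⟩ := Ideal.Quotient.mk_surjective y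
  rw [quotSpanMul_mk] at hy
  rw [Ideal.Quotient.eq_zero_iff_mem, Ideal.mem_span_singleton]
  exact h c hy

lemma quotSpanMul_exact {a b : R} (hab : b * a = 0) :
    Function.Exact (quotSpanMul hab) (Submodule.mkQ (Ideal.span {b})) := by
  intro y
  rw [Submodule.mkQ_apply, Submodule.Quotient.mk_eq_zero, Ideal.mem_span_singleton]
  constructor
  · rintro ⟨c, rfl⟩
    exact ⟨Ideal.Quotient.mk _ c, quotSpanMul_mk hab c⟩
  · rintro ⟨z, rfl⟩
    obtain ⟨c, rfl⟩ := Ideal.Quotient.mk_surjective z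
    exact ⟨c, quotSpanMul_mk hab c⟩

lemma torLength_quot_span_succ_succ (M : Type u) [AddCommGroup M] [Module R M] {a b : R}
    (hab : b * a = 0) (h : ∀ c, b * c = 0 → a ∣ c) (n : ℕ) :
    torLength R M (R ⧸ Ideal.span {b}) (n + 2) = torLength R M (R ⧸ Ideal.span {a}) (n + 1) :=
  torLength_succ_succ (K := R ⧸ Ideal.span {a}) (F := R) M (quotSpanMul_injective hab h)
    (quotSpanMul_exact hab) (Submodule.mkQ_surjective _) n

lemma torLength_quot_span_one (M : Type u) [AddCommGroup M] [Module R M] {a b : R}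
    (hab : b * a = 0) (h : ∀ c, b * c = 0 → a ∣ c) :
    torLength R M (R ⧸ Ideal.span {b}) 1 =
      Module.length R (LinearMap.ker ((quotSpanMul hab).lTensor M)) :=
  torLength_one (K := R ⧸ Ideal.span {a}) (F := R) M (quotSpanMul_injective hab h)
    (quotSpanMul_exact hab) (Submodule.mkQ_surjective _)

lemma rid_lTensor_quotSpanMul (M : Type u) [AddCommGroup M] [Module R M] {a b : R}
    (hab : b * a = 0) (y : M) :
    TensorProduct.rid R M ((quotSpanMul hab).lTensor M (y ⊗ₜ 1)) = b • y := by
  rw [LinearMap.lTensor_tmul, ← map_one (Ideal.Quotient.mk (Ideal.span {a})), quotSpanMul_mk,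
    TensorProduct.rid_tmul, mul_one]

lemma exists_eq_tmul_one (M : Type u) [AddCommGroup M] [Module R M] (I : Ideal R)
    (z : M ⊗[R] (R ⧸ I)) : ∃ y : M, z = y ⊗ₜ 1 := by
  induction z with
  | zero => exact ⟨0, by simp⟩
  | tmul y c =>
    obtain ⟨c, rfl⟩ := Ideal.Quotient.mk_surjective c
    refine ⟨c • y, ?_⟩
    rw [TensorProduct.smul_tmul, Algebra.smul_def, mul_one]
    rfl
  | add z w hz hw =>
    obtain ⟨y, rfl⟩ := hz
    obtain ⟨y', rfl⟩ := hw
    exact ⟨y + y', (TensorProduct.add_tmul _ _ _).symm⟩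

lemma torLength_quot_span_one_eq_zero (M : Type u) [AddCommGroup M] [Module R M] {a b : R}
    (hab : b * a = 0) (h : ∀ c, b * c = 0 → a ∣ c) (hM : ∀ y : M, b • y = 0 → y = 0) :
    torLength R M (R ⧸ Ideal.span {b}) 1 = 0 := by
  rw [torLength_quot_span_one M hab h, Module.length_eq_zero_iff, Submodule.subsingleton_iff_eq_bot,
    LinearMap.ker_eq_bot, injective_iff_map_eq_zero]
  intro z hz
  obtain ⟨y, rfl⟩ := exists_eq_tmul_one M _ z
  have := rid_lTensor_quotSpanMul M hab y
  rw [hz, map_zero] at this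
  rw [hM y this.symm, TensorProduct.zero_tmul]

lemma torLength_quot_span_one_eq_length (M : Type u) [AddCommGroup M] [Module R M] {a b : R}
    (hab : b * a = 0) (h : ∀ c, b * c = 0 → a ∣ c) (hM : ∀ y : M, b • y = 0) :
    torLength R M (R ⧸ Ideal.span {b}) 1 = Module.length R (M ⊗[R] (R ⧸ Ideal.span {a})) := by
  have : LinearMap.ker ((quotSpanMul hab).lTensor M) = ⊤ := by
    refine eq_top_iff.2 fun z _ => ?_
    obtain ⟨y, rfl⟩ := exists_eq_tmul_one M _ z
    refine (TensorProduct.rid R M).injective ?_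
    rw [rid_lTensor_quotSpanMul, hM, map_zero]
  rw [torLength_quot_span_one M hab h, this, Module.length_top]

lemma nontrivial_quotient_tensorProduct [IsLocalRing R] {I J : Ideal R} (hI : I ≤ maximalIdeal R)
    (hJ : J ≤ maximalIdeal R) : Nontrivial ((R ⧸ I) ⊗[R] (R ⧸ J)) := by
  let φ : (R ⧸ I) ⊗[R] (R ⧸ J) →ₗ[R] R ⧸ maximalIdeal R :=
    LinearMap.mul' R (R ⧸ maximalIdeal R) ∘ₗ TensorProduct.map
      (Ideal.Quotient.factorₐ R hI).toLinearMap (Ideal.Quotient.factorₐ R hJ).toLinearMap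
  refine ⟨1 ⊗ₜ 1, 0, fun h => ?_⟩
  have h1 := congrArg φ h
  have h2 : φ (1 ⊗ₜ 1) =
      Ideal.Quotient.factorₐ R hI 1 * Ideal.Quotient.factorₐ R hJ 1 := rfl
  rw [h2, map_zero, map_one, map_one, mul_one] at h1
  have := Ideal.Quotient.nontrivial_iff.2 (maximalIdeal.isMaximal R).ne_top
  exact one_ne_zero h1

/-- Positivity of `θ` on a pair of distinct components. -/
lemma hochsterThetaAt_two_pos [IsLocalRing R] {q : Ideal R} (hq : q.IsPrime) {a b : R}
    (hba : b * a = 0) (hb : ∀ c, b * c = 0 → a ∣ c) (ha : ∀ c, a * c = 0 → b ∣ c)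
    (haq : a ∉ q) (ham : a ∈ maximalIdeal R)
    (hfin : torLength R (R ⧸ q) (R ⧸ Ideal.span {a}) 6 ≠ ⊤) :
    0 < hochsterThetaAt R (R ⧸ q) (R ⧸ Ideal.span {a}) 2 := by
  have hab : a * b = 0 := (mul_comm a b).trans hba
  have hbq : b ∈ q := (hq.mem_or_mem (hba ▸ q.zero_mem)).resolve_right haq
  have s1 := torLength_quot_span_succ_succ (R ⧸ q) hba hb
  have s2 := torLength_quot_span_succ_succ (R ⧸ q) hab ha
  have h5 : torLength R (R ⧸ q) (R ⧸ Ideal.span {a}) 5 = 0 := by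
    -- The two shifts alternate between R/(a) and R/(b): Tor_5 of R/(a) becomes Tor_1 of R/(a), and
    -- Tor_6 becomes Tor_1 of R/(b). On R/q, a acts injectively and b acts as zero.
    rw [s2 3, s1 2, s2 1, s1 0]
    refine torLength_quot_span_one_eq_zero _ hab ha fun y hy => ?_
    obtain ⟨c, rfl⟩ := Ideal.Quotient.mk_surjective y
    rw [Algebra.smul_def, Ideal.Quotient.algebraMap_eq, ← map_mul,
      Ideal.Quotient.eq_zero_iff_mem] at hy
    exact Ideal.Quotient.eq_zero_iff_mem.2 ((hq.mem_or_mem hy).resolve_left haq)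
  have h6 : torLength R (R ⧸ q) (R ⧸ Ideal.span {a}) 6 ≠ 0 := by
    rw [s2 4, s1 3, s2 2, s1 1, s2 0, torLength_quot_span_one_eq_length _ hba hb, Ne,
      Module.length_eq_zero_iff, not_subsingleton_iff_nontrivial]
    · refine nontrivial_quotient_tensorProduct (le_maximalIdeal hq.ne_top) ?_
      rwa [Ideal.span_singleton_le_iff_mem]
    · intro y
      obtain ⟨c, rfl⟩ := Ideal.Quotient.mk_surjective y
      rw [Algebra.smul_def, Ideal.Quotient.algebraMap_eq, ← map_mul,
        Ideal.Quotient.eq_zero_iff_mem]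
      exact q.mul_mem_right _ hbq
  change 0 < ((torLength R (R ⧸ q) (R ⧸ Ideal.span {a}) 6).toNat : ℤ) -
    ((torLength R (R ⧸ q) (R ⧸ Ideal.span {a}) 5).toNat : ℤ)
  rw [h5, ENat.toNat_zero, Nat.cast_zero, sub_zero, Nat.cast_pos]
  exact Nat.pos_of_ne_zero fun h => (ENat.toNat_eq_zero.1 h).elim h6 hfin

/-- The ideal p vanishes in the field R_p, and p is finitely generated, so one multiplier outside p
kills all of it. -/
lemma exists_notMem_mul_eq_zero [IsNoetherianRing R] (p : Ideal R) [p.IsPrime]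
    (hp : IsField (Localization.AtPrime p)) : ∃ s ∉ p, ∀ c ∈ p, s * c = 0 := by
  obtain ⟨s, hs⟩ := Module.Finite.exists_smul_of_comp_eq_of_isLocalizedModule p.primeCompl
    (Algebra.linearMap R (Localization.AtPrime p)) p.subtype 0 (by
      ext c
      have : algebraMap R (Localization.AtPrime p) c ∈ maximalIdeal (Localization.AtPrime p) :=
        (IsLocalization.AtPrime.to_map_mem_maximal_iff _ p c.1).2 c.2
      rw [isField_iff_maximalIdeal_eq.1 hp] at this
      simpa using this)
  refine ⟨s, s.2, fun c hc => ?_⟩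
  have := LinearMap.congr_fun hs ⟨c, hc⟩
  simpa [Submonoid.smul_def] using this

lemma notMem_of_isSMulRegular [IsNoetherianRing R] {p : Ideal R} [p.IsPrime]
    (hp : IsField (Localization.AtPrime p)) {x : R} (hx : IsSMulRegular R x) : x ∉ p := by
  obtain ⟨s, hs, h⟩ := exists_notMem_mul_eq_zero p hp
  refine fun hxp => hs ?_
  have h0 : x * s = 0 := (mul_comm x s).trans (h x hxp)
  rw [show s = 0 from hx (h0.trans (smul_zero x).symm)]
  exact p.zero_mem

/-- Some s ∉ q kills q, so s · q lies in p while s ∉ p; thus q ≤ p. -/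
lemma eq_of_le_of_isField [IsNoetherianRing R] {p q : Ideal R} (hp : p.IsPrime) [q.IsPrime]
    (hq : IsField (Localization.AtPrime q)) (h : p ≤ q) : p = q := by
  obtain ⟨s, hs, hsq⟩ := exists_notMem_mul_eq_zero q hq
  exact le_antisymm h fun c hc =>
    (hp.mem_or_mem (hsq c hc ▸ p.zero_mem)).resolve_left fun hsp => hs (h hsp)

/-- Minimal primes are generated by one element of a pair of mutual annihilators. -/
lemma exists_mutual_annihilators [IsNoetherianRing R] {x : R} (hx : IsSMulRegular R x)
    (hprinc : ∀ J : Ideal R, IsSMulRegular (R ⧸ J) x → J.IsPrincipal)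
    (p : Ideal R) [p.IsPrime] (hp : IsField (Localization.AtPrime p)) :
    ∃ a b : R, p = Ideal.span {a} ∧ b * a = 0 ∧ (∀ c, b * c = 0 → a ∣ c) ∧
      ∀ c, a * c = 0 → b ∣ c := by
  have hxp := notMem_of_isSMulRegular hp hx
  obtain ⟨s, hs, h⟩ := exists_notMem_mul_eq_zero p hp
  obtain ⟨a, ha⟩ := hprinc p ((isSMulRegular_iff_right_eq_zero_of_smul).2 fun y hy => by
    obtain ⟨c, rfl⟩ := Ideal.Quotient.mk_surjective y
    rw [Algebra.smul_def, Ideal.Quotient.algebraMap_eq, ← map_mul,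
      Ideal.Quotient.eq_zero_iff_mem] at hy
    exact Ideal.Quotient.eq_zero_iff_mem.2 ((‹p.IsPrime›.mem_or_mem hy).resolve_left hxp))
  change p = Ideal.span {a} at ha
  have hap : a ∈ p := ha ▸ Ideal.mem_span_singleton_self a
  let A : Ideal R := LinearMap.ker (LinearMap.mulLeft R a)
  have hA : ∀ c, c ∈ A ↔ a * c = 0 := fun c => Iff.rfl
  obtain ⟨b, hb⟩ := hprinc A ((isSMulRegular_iff_right_eq_zero_of_smul).2 fun y hy => by
    obtain ⟨c, rfl⟩ := Ideal.Quotient.mk_surjective y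
    rw [Algebra.smul_def, Ideal.Quotient.algebraMap_eq, ← map_mul,
      Ideal.Quotient.eq_zero_iff_mem, hA, mul_left_comm] at hy
    exact Ideal.Quotient.eq_zero_iff_mem.2 ((hA c).2 (hx (hy.trans (smul_zero x).symm))))
  change A = Ideal.span {b} at hb
  have hab : a * b = 0 := (hA b).1 (hb ▸ Ideal.mem_span_singleton_self b)
  refine ⟨a, b, ha, (mul_comm b a).trans hab, fun c hc => ?_, fun c hc => ?_⟩
  -- The annihilator of p contains some s ∉ p, and s = bd. If bc = 0 then sc = 0 lies in p, so c
  -- lies in p = (a).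
  · have hsA : s ∈ A := (hA s).2 ((mul_comm a s).trans (h a hap))
    rw [hb, Ideal.mem_span_singleton] at hsA
    obtain ⟨d, rfl⟩ := hsA
    rw [← Ideal.mem_span_singleton, ← ha]
    refine (‹p.IsPrime›.mem_or_mem (x := b * d) (y := c) ?_).resolve_left hs
    rw [mul_right_comm, hc, zero_mul]
    exact p.zero_mem
  · rw [← Ideal.mem_span_singleton, ← hb]
    exact (hA c).2 hc

/-- The maximal ideal contains a regular element and so is not associated; any other prime p is the
annihilator of the element b of its annihilator pair. -/
lemma mem_associatedPrimes_iff [IsLocalRing R] [IsNoetherianRing R] {x : R}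
    (hxm : x ∈ maximalIdeal R) (hx : IsSMulRegular R x)
    (hprinc : ∀ J : Ideal R, IsSMulRegular (R ⧸ J) x → J.IsPrincipal)
    (hfld : ∀ (p : Ideal R) [p.IsPrime], p ≠ maximalIdeal R → IsField (Localization.AtPrime p))
    (p : Ideal R) [hpp : p.IsPrime] : p ∈ associatedPrimes R R ↔ p ≠ maximalIdeal R := by
  rw [AssociatedPrimes.mem_iff, isAssociatedPrime_iff]
  constructor
  · rintro ⟨-, z, hz⟩ rfl
    rw [hz, Submodule.mem_colon_singleton, Submodule.mem_bot] at hxm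
    have hz0 : z = 0 := hx (hxm.trans (smul_zero x).symm)
    refine hpp.ne_top (hz.trans ?_)
    rw [hz0]; simp
  · intro hp
    obtain ⟨a, b, ha, hba, hb, -⟩ := exists_mutual_annihilators hx hprinc p (hfld p hp)
    refine ⟨hpp, b, ?_⟩
    ext c
    rw [Submodule.mem_colon_singleton, Submodule.mem_bot, ha, Ideal.mem_span_singleton,
      smul_eq_mul, mul_comm]
    refine ⟨?_, hb c⟩
    rintro ⟨d, rfl⟩
    rw [← mul_assoc, hba, zero_mul]

end MinimalPrimes

/-! ### Local ranks and classes in the Grothendieck group -/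

section LocalRank

open IsLocalRing

variable {R : Type u} [CommRing R]

/-- The rank of `M` at the prime `p`. -/
noncomputable def localRank (p : Ideal R) [p.IsPrime] (M : Type*) [AddCommGroup M] [Module R M] :
    ℕ :=
  Module.finrank (Localization.AtPrime p) (LocalizedModule p.primeCompl M)

variable (p : Ideal R) [p.IsPrime]

lemma localRank_eq_zero {M : Type*} [AddCommGroup M] [Module R M]
    (h : ∀ y : M, ∃ s ∉ p, s • y = 0) : localRank p M = 0 := by
  have : Subsingleton (LocalizedModule p.primeCompl M) := LocalizedModule.subsingleton_iff.2 h
  exact Module.finrank_zero_of_subsingleton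

lemma localRank_self : localRank p R = 1 := by
  have e : LocalizedModule p.primeCompl R ≃ₗ[Localization.AtPrime p] Localization.AtPrime p :=
    LinearEquiv.extendScalarsOfIsLocalization p.primeCompl _
      (IsLocalizedModule.iso p.primeCompl (Algebra.linearMap R (Localization.AtPrime p)))
  rw [localRank, e.finrank_eq, Module.finrank_self]

lemma localRank_additive (hp : IsField (Localization.AtPrime p))
    {M₁ M₂ M₃ : Type*} [AddCommGroup M₁] [Module R M₁] [AddCommGroup M₂] [Module R M₂]
    [Module.Finite R M₂] [AddCommGroup M₃] [Module R M₃]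
    {f : M₁ →ₗ[R] M₂} {g : M₂ →ₗ[R] M₃} (hf : Function.Injective f)
    (hfg : Function.Exact f g) (hg : Function.Surjective g) :
    localRank p M₂ = localRank p M₁ + localRank p M₃ := by
  let S := p.primeCompl
  have hf' := LocalizedModule.map_injective S f hf
  have hg' := LocalizedModule.map_surjective S g hg
  have hfg' : LinearMap.ker (LocalizedModule.map S g) = LinearMap.range (LocalizedModule.map S f) :=
    LinearMap.exact_iff.1 (LocalizedModule.map_exact S f g hfg)
  let := hp.toField
  have h := LinearMap.finrank_range_add_finrank_ker (LocalizedModule.map S g)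
  rw [LinearMap.range_eq_top.2 hg', finrank_top] at h
  rw [localRank, ← h, add_comm]
  congr 1
  rw [hfg']
  exact (LinearMap.finrank_range_of_inj hf')

lemma nonempty_equiv_iff_localRank_eq (hp : IsField (Localization.AtPrime p)) (M : Type*)
    [AddCommGroup M] [Module R M] [Module.Finite R M] (r : ℕ) :
    Nonempty (LocalizedModule p.primeCompl M ≃ₗ[Localization.AtPrime p]
      (Fin r → Localization.AtPrime p)) ↔ localRank p M = r := by
  constructor
  · rintro ⟨e⟩
    rw [localRank, e.finrank_eq, Module.finrank_fin_fun]
  · rintro rfl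
    let := hp.toField
    exact ⟨(Module.finBasis _ _).equivFun⟩

end LocalRank

section ReducedClass

variable {R : Type u} [CommRing R]

lemma reducedClassRat_additive {M₁ M₂ M₃ : Type u} [AddCommGroup M₁] [Module R M₁]
    [Module.Finite R M₁] [AddCommGroup M₂] [Module R M₂] [Module.Finite R M₂]
    [AddCommGroup M₃] [Module R M₃] [Module.Finite R M₃]
    {f : M₁ →ₗ[R] M₂} {g : M₂ →ₗ[R] M₃} (hf : Function.Injective f)
    (hfg : Function.Exact f g) (hg : Function.Surjective g) :
    reducedClassRat R M₂ = reducedClassRat R M₁ + reducedClassRat R M₃ := by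
  have h : moduleClass R M₂ = moduleClass R M₁ + moduleClass R M₃ := by
    rw [← sub_eq_zero, ← sub_sub]
    exact (QuotientAddGroup.eq_zero_iff _).2 (AddSubgroup.subset_closure
      ⟨FGModuleCat.of R M₁, FGModuleCat.of R M₂, FGModuleCat.of R M₃, f, g, hf, hfg, hg, rfl⟩)
  unfold reducedClassRat reducedClass
  rw [h, QuotientAddGroup.mk_add, TensorProduct.tmul_add]

lemma reducedClassRat_of_subsingleton (M : Type u) [AddCommGroup M] [Module R M]
    [Module.Finite R M] [Subsingleton M] : reducedClassRat R M = 0 := by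
  have h := reducedClassRat_additive (f := (LinearMap.id : M →ₗ[R] M))
    (g := (LinearMap.id : M →ₗ[R] M)) Function.injective_id
    (fun y => ⟨fun _ => ⟨y, rfl⟩, fun _ => Subsingleton.elim _ _⟩) Function.surjective_id
  exact left_eq_add.1 h

lemma reducedClassRat_congr {M N : Type u} [AddCommGroup M] [Module R M] [Module.Finite R M]
    [AddCommGroup N] [Module R N] [Module.Finite R N] (e : M ≃ₗ[R] N) :
    reducedClassRat R M = reducedClassRat R N := by
  have h := reducedClassRat_additive (f := (0 : PUnit.{u + 1} →ₗ[R] M)) (g := e.toLinearMap)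
    (Function.injective_of_subsingleton _)
    ((LinearMap.exact_zero_iff_injective _ _).2 e.injective) e.surjective
  rwa [reducedClassRat_of_subsingleton PUnit, zero_add] at h

variable (R) in
lemma reducedClassRat_self : reducedClassRat R R = 0 := by
  have : reducedClass R R = 0 :=
    (QuotientAddGroup.eq_zero_iff _).2 (AddSubgroup.mem_zmultiples _)
  rw [reducedClassRat, this, TensorProduct.tmul_zero]

lemma eq_zero_of_nsmul_eq_zero {G : Type*} [AddCommGroup G] {n : ℕ} (hn : n ≠ 0)
    {z : ℚ ⊗[ℤ] G} (h : n • z = 0) : z = 0 := by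
  rw [← Nat.cast_smul_eq_nsmul ℚ] at h
  exact (smul_eq_zero.1 h).resolve_left (Nat.cast_ne_zero.2 hn)

/-- An additive invariant that vanishes on `R` factors through the reduced Grothendieck group. -/
lemma exists_hom_reducedClassRat
    (φ : ∀ (M : Type u) [AddCommGroup M] [Module R M] [Module.Finite R M], ℤ)
    (hφ : ∀ (M₁ M₂ M₃ : Type u) [AddCommGroup M₁] [Module R M₁]
      [Module.Finite R M₁] [AddCommGroup M₂] [Module R M₂] [Module.Finite R M₂]
      [AddCommGroup M₃] [Module R M₃] [Module.Finite R M₃]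
      (f : M₁ →ₗ[R] M₂) (g : M₂ →ₗ[R] M₃), Function.Injective f → Function.Exact f g →
      Function.Surjective g → φ M₂ = φ M₁ + φ M₃) (hR : φ R = 0) :
    ∃ Φ : ℚ ⊗[ℤ] ReducedGrothendieckGroup R →+ ℚ,
      ∀ (M : Type u) [AddCommGroup M] [Module R M] [Module.Finite R M],
        Φ (reducedClassRat R M) = φ M := by
  let F : FreeAbelianGroup (FGModuleCat.{u} R) →+ ℚ :=
    FreeAbelianGroup.lift fun M => (φ M : ℚ)
  have hF : ∀ z ∈ shortExactRelations R, F z = 0 := by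
    intro z hz
    refine (AddSubgroup.closure_le F.ker).2 ?_ hz
    rintro _ ⟨M₁, M₂, M₃, f, g, hf, hfg, hg, rfl⟩
    change F _ = 0
    rw [map_sub, map_sub, FreeAbelianGroup.lift_apply_of, FreeAbelianGroup.lift_apply_of,
      FreeAbelianGroup.lift_apply_of, hφ M₁ M₂ M₃ f g hf hfg hg]
    push_cast
    ring
  let F₁ : ModuleGrothendieckGroup R →+ ℚ := QuotientAddGroup.lift _ F hF
  have hF₁ (M : Type u) [AddCommGroup M] [Module R M] [Module.Finite R M] :
      F₁ (moduleClass R M) = φ M := FreeAbelianGroup.lift_apply_of _ _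
  let F₂ : ReducedGrothendieckGroup R →+ ℚ := QuotientAddGroup.lift _ F₁ (by
    intro z hz
    obtain ⟨k, rfl⟩ := AddSubgroup.mem_zmultiples_iff.1 hz
    rw [AddMonoidHom.mem_ker, map_zsmul, hF₁, hR, Int.cast_zero, smul_zero])
  refine ⟨(LinearMap.mul' ℤ ℚ ∘ₗ F₂.toIntLinearMap.lTensor ℚ).toAddMonoidHom, fun M _ _ _ => ?_⟩
  change 1 * F₁ (moduleClass R M) = φ M
  rw [hF₁, one_mul]

end ReducedClass

section ClassFormula

open IsLocalRing

variable {R : Type u} [CommRing R] [IsNoetherianRing R]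

omit [IsNoetherianRing R] in
lemma localRank_congr (p : Ideal R) [p.IsPrime] (hp : IsField (Localization.AtPrime p))
    {M N : Type u} [AddCommGroup M] [Module R M] [Module.Finite R M]
    [AddCommGroup N] [Module R N] (e : M ≃ₗ[R] N) : localRank p M = localRank p N := by
  have h := localRank_additive p hp (f := (0 : PUnit.{u + 1} →ₗ[R] M)) (g := e.toLinearMap)
    (Function.injective_of_subsingleton _)
    ((LinearMap.exact_zero_iff_injective _ _).2 e.injective) e.surjective
  rwa [localRank_eq_zero p (M := PUnit.{u + 1})
    fun _ => ⟨1, ‹p.IsPrime›.one_notMem, Subsingleton.elim _ _⟩, zero_add] at h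

lemma localRank_quotient_of_ne (p : Ideal R) [p.IsPrime] (hp : IsField (Localization.AtPrime p))
    {q : Ideal R} (hq : q.IsPrime) (hqp : q ≠ p) : localRank p (R ⧸ q) = 0 := by
  obtain ⟨s, hsq, hsp⟩ := SetLike.not_le_iff_exists.1 fun h => hqp (eq_of_le_of_isField hq hp h)
  refine localRank_eq_zero p fun y => ⟨s, hsp, ?_⟩
  rw [Algebra.smul_def, Ideal.Quotient.algebraMap_eq, Ideal.Quotient.eq_zero_iff_mem.2 hsq,
    zero_mul]

/-- An element outside p kills p, so p has rank zero and R/p inherits the rank of R. -/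
lemma localRank_quotient_self (p : Ideal R) [p.IsPrime] (hp : IsField (Localization.AtPrime p)) :
    localRank p (R ⧸ p) = 1 := by
  have h := localRank_additive p hp (f := p.subtype) (g := Submodule.mkQ p)
    Subtype.val_injective (LinearMap.exact_subtype_mkQ p) (Submodule.mkQ_surjective p)
  obtain ⟨s, hs, hsp⟩ := exists_notMem_mul_eq_zero p hp
  rw [localRank_self, localRank_eq_zero p (M := p) fun y => ⟨s, hs, Subtype.ext (hsp y y.2)⟩,
    zero_add] at h
  exact h.symm

variable [IsLocalRing R]

/-- Dévissage of the class of a module in the reduced Grothendieck group. -/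
lemma exists_reducedClassRat_eq
    (hfld : ∀ (p : Ideal R) [p.IsPrime], p ≠ maximalIdeal R → IsField (Localization.AtPrime p))
    {P : Finset (PrimeSpectrum R)} (hP : ∀ p, p ∈ P ↔ p.asIdeal ≠ maximalIdeal R)
    (M : Type u) [AddCommGroup M] [Module R M] [hM : Module.Finite R M] :
    ∃ c : ℕ, reducedClassRat R M = c • reducedClassRat R (R ⧸ maximalIdeal R) +
        ∑ p ∈ P, localRank p.asIdeal M • reducedClassRat R (R ⧸ p.asIdeal) ∧
      (c = 0 → Nontrivial M → ∃ p ∈ P, localRank p.asIdeal M ≠ 0) := by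
  classical
  -- In a prime filtration c counts the residue field factors, and rank_p counts the factors R/p.
  -- Nothing cancels, so a nonzero module with all ranks zero must have c > 0.
  induction hM using IsNoetherianRing.induction_on_isQuotientEquivQuotientPrime R with
  | subsingleton N =>
    refine ⟨0, ?_, fun _ h => absurd h (not_nontrivial N)⟩
    rw [reducedClassRat_of_subsingleton, zero_smul, zero_add, Finset.sum_eq_zero]
    intro p _
    rw [localRank_eq_zero p.asIdeal
      fun _ => ⟨1, p.2.one_notMem, Subsingleton.elim _ _⟩, zero_smul]
  | quotient N q e =>
    by_cases hq : q.asIdeal = maximalIdeal R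
    · refine ⟨1, ?_, fun h => absurd h one_ne_zero⟩
      rw [reducedClassRat_congr (e.trans (Submodule.quotEquivOfEq _ _ hq)), one_smul,
        Finset.sum_eq_zero, add_zero]
      intro p hp
      have hp' := hfld p.asIdeal ((hP p).1 hp)
      rw [localRank_congr p.asIdeal hp' e,
        localRank_quotient_of_ne p.asIdeal hp' q.2 (hq.trans_ne ((hP p).1 hp).symm), zero_smul]
    · have hqP := (hP q).2 hq
      have h1 : localRank q.asIdeal N = 1 := by
        rw [localRank_congr q.asIdeal (hfld _ hq) e, localRank_quotient_self _ (hfld _ hq)]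
      refine ⟨0, ?_, fun _ _ => ⟨q, hqP, h1.trans_ne one_ne_zero⟩⟩
      rw [reducedClassRat_congr e, zero_smul, zero_add, Finset.sum_eq_single q, h1, one_smul]
      · intro p hp hpq
        have hp' := hfld p.asIdeal ((hP p).1 hp)
        rw [localRank_congr p.asIdeal hp' e, localRank_quotient_of_ne p.asIdeal hp' q.2
          fun h => hpq (PrimeSpectrum.ext h.symm), zero_smul]
      · exact fun h => absurd hqP h
  | exact N₁ N₂ N₃ f g hf hg hfg h₁ h₃ =>
    obtain ⟨c₁, e₁, n₁⟩ := h₁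
    obtain ⟨c₃, e₃, n₃⟩ := h₃
    have hr (p) (hp : p ∈ P) := localRank_additive p.asIdeal (hfld p.asIdeal ((hP p).1 hp)) hf hfg hg
    refine ⟨c₁ + c₃, ?_, fun hc hn => ?_⟩
    · rw [reducedClassRat_additive hf hfg hg, e₁, e₃, add_smul, add_add_add_comm,
        ← Finset.sum_add_distrib]
      congr 1
      exact Finset.sum_congr rfl fun p hp => by rw [hr p hp, add_smul]
    · rcases subsingleton_or_nontrivial N₁ with hs | hs
      · have : Nontrivial N₃ := by
          by_contra hN
          rw [not_nontrivial_iff_subsingleton] at hN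
          refine not_subsingleton N₂ ⟨fun y z => ?_⟩
          have hz : ∀ y : N₂, y = 0 := fun y => by
            obtain ⟨w, rfl⟩ := (hfg y).1 (Subsingleton.elim _ _)
            rw [Subsingleton.elim w 0, map_zero]
          rw [hz y, hz z]
        obtain ⟨p, hp, h⟩ := n₃ (by omega) this
        exact ⟨p, hp, by rw [hr p hp]; omega⟩
      · obtain ⟨p, hp, h⟩ := n₁ (by omega) hs
        exact ⟨p, hp, by rw [hr p hp]; omega⟩

/-- In the reduced Grothendieck group, a class is determined by the local ranks. -/
lemma reducedClassRat_eq_sum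
    (hfld : ∀ (p : Ideal R) [p.IsPrime], p ≠ maximalIdeal R → IsField (Localization.AtPrime p))
    {x : R} (hxm : x ∈ maximalIdeal R) (hx : IsSMulRegular R x)
    {P : Finset (PrimeSpectrum R)} (hP : ∀ p, p ∈ P ↔ p.asIdeal ≠ maximalIdeal R)
    (M : Type u) [AddCommGroup M] [Module R M] [Module.Finite R M] :
    reducedClassRat R M =
      ∑ p ∈ P, localRank p.asIdeal M • reducedClassRat R (R ⧸ p.asIdeal) := by
  -- R/(x) has class zero but is nonzero with all ranks zero, so a positive multiple of the residue
  -- field class vanishes. Rational coefficients are needed to divide by it.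
  have hk : reducedClassRat R (R ⧸ maximalIdeal R) = 0 := by
    obtain ⟨c, hc, hc0⟩ := exists_reducedClassRat_eq hfld hP (R ⧸ Ideal.span {x})
    have hr : ∀ p ∈ P, localRank p.asIdeal (R ⧸ Ideal.span {x}) = 0 := by
      intro p hp
      refine localRank_eq_zero _ fun y =>
        ⟨x, notMem_of_isSMulRegular (hfld p.asIdeal ((hP p).1 hp)) hx, ?_⟩
      rw [Algebra.smul_def, Ideal.Quotient.algebraMap_eq,
        Ideal.Quotient.eq_zero_iff_mem.2 (Ideal.mem_span_singleton_self x), zero_mul]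
    have h0 : reducedClassRat R (R ⧸ Ideal.span {x}) = 0 := by
      have h := reducedClassRat_additive (f := LinearMap.mulLeft R x)
        (g := Submodule.mkQ (Ideal.span {x})) hx (by
          intro y
          rw [Submodule.mkQ_apply, Submodule.Quotient.mk_eq_zero, Ideal.mem_span_singleton]
          exact ⟨fun ⟨c, h⟩ => ⟨c, h.symm⟩, fun ⟨c, h⟩ => ⟨c, h.symm⟩⟩)
        (Submodule.mkQ_surjective _)
      rw [reducedClassRat_self, zero_add] at h
      exact h.symm
    have : Nontrivial (R ⧸ Ideal.span {x}) := Ideal.Quotient.nontrivial_iff.2 fun h =>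
      (maximalIdeal.isMaximal R).ne_top
        (top_le_iff.1 (h ▸ (Ideal.span_singleton_le_iff_mem _).2 hxm))
    have hcne : c ≠ 0 := fun h => by
      obtain ⟨p, hp, h⟩ := hc0 h this
      exact h (hr p hp)
    rw [h0, Finset.sum_eq_zero fun p hp => by rw [hr p hp, zero_smul], add_zero] at hc
    exact eq_zero_of_nsmul_eq_zero hcne hc.symm
  obtain ⟨c, hc, -⟩ := exists_reducedClassRat_eq hfld hP M
  rw [hc, hk, smul_zero, zero_add]

end ClassFormula

/-! ### Laplacian argument and the equivalences -/

/-- A weighted Laplacian with positive weights has only constants in its kernel. -/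
lemma exists_forall_eq_of_sum_mul_eq_zero {ι : Type*} {P : Finset ι} {θ : ι → ι → ℚ} {r : ι → ℕ}
    (hpos : ∀ i ∈ P, ∀ j ∈ P, i ≠ j → 0 < θ i j) (h0 : ∀ j ∈ P, ∑ i ∈ P, θ i j = 0)
    (h : ∀ j ∈ P, ∑ i ∈ P, (r i : ℚ) * θ i j = 0) : ∃ c, ∀ i ∈ P, r i = c := by
  rcases P.eq_empty_or_nonempty with rfl | hne
  · exact ⟨0, by simp⟩
  -- Minimum principle: at a minimum j of r all terms (r i - r j) θ i j are nonnegative and sum to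
  -- zero. The diagonal term has coefficient zero, so the sign of θ j j is irrelevant.
  obtain ⟨j, hj, hmin⟩ := P.exists_min_image r hne
  refine ⟨r j, fun i hi => ?_⟩
  by_contra hij
  have hs : ∑ i ∈ P, ((r i : ℚ) - r j) * θ i j = 0 := by
    simp_rw [sub_mul]
    rw [Finset.sum_sub_distrib, ← Finset.mul_sum, h0 j hj, h j hj]
    ring
  have hnn : ∀ k ∈ P, 0 ≤ ((r k : ℚ) - r j) * θ k j := by
    intro k hk
    rcases eq_or_ne k j with rfl | hkj
    · simp
    · exact mul_nonneg (sub_nonneg.2 (Nat.cast_le.2 (hmin k hk))) (hpos k hk j hj hkj).le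
  have hi0 := (Finset.sum_eq_zero_iff_of_nonneg hnn).1 hs i hi
  have hne' : i ≠ j := fun h => hij (h ▸ rfl)
  rcases mul_eq_zero.1 hi0 with h1 | h1
  · exact hij (Nat.cast_injective (R := ℚ) (sub_eq_zero.1 h1))
  · exact (hpos i hi j hj hne').ne' h1

section ThetaHom

variable {R : Type u} [CommRing R]

lemma hochsterTheta_eq (hdim : ringKrullDim R = 1) (M N : Type u) [AddCommGroup M] [Module R M]
    [AddCommGroup N] [Module R N] : hochsterTheta R M N = hochsterThetaAt R M N 2 := by
  rw [hochsterTheta, krullDimNat_eq_one hdim]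

lemma hochsterTheta_self (hdim : ringKrullDim R = 1) (N : Type u) [AddCommGroup N] [Module R N] :
    hochsterTheta R R N = 0 := by
  rw [hochsterTheta_eq hdim, hochsterThetaAt, torLength_of_flat, torLength_of_flat]
  simp

lemma exists_hom_hochsterTheta (hdim : ringKrullDim R = 1) {N : Type u} [AddCommGroup N]
    [Module R N]
    (hfin : ∀ (M : Type u) [AddCommGroup M] [Module R M] [Module.Finite R M] (n : ℕ),
      torLength R M N (n + 1) ≠ ⊤)
    (hper : ∀ (M : Type u) [AddCommGroup M] [Module R M] (n : ℕ), 3 ≤ n →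
      torLength R M N (n + 2) = torLength R M N n) :
    ∃ Φ : ℚ ⊗[ℤ] ReducedGrothendieckGroup R →+ ℚ,
      ∀ (M : Type u) [AddCommGroup M] [Module R M] [Module.Finite R M],
        Φ (reducedClassRat R M) = hochsterTheta R M N := by
  have hadd (M₁ M₂ M₃ : Type u) [AddCommGroup M₁] [Module R M₁]
      [Module.Finite R M₁] [AddCommGroup M₂] [Module R M₂] [Module.Finite R M₂]
      [AddCommGroup M₃] [Module R M₃] [Module.Finite R M₃]
      (f : M₁ →ₗ[R] M₂) (g : M₂ →ₗ[R] M₃) (hf : Function.Injective f)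
      (hfg : Function.Exact f g) (hg : Function.Surjective g) :
      hochsterTheta R M₂ N = hochsterTheta R M₁ N + hochsterTheta R M₃ N := by
    rw [hochsterTheta_eq hdim, hochsterTheta_eq hdim, hochsterTheta_eq hdim]
    exact hochsterThetaAt_additive N hf hfg hg (hfin M₁) (hfin M₂) (hfin M₃) (hper M₁) (hper M₂)
      (hper M₃) (by omega)
  exact exists_hom_reducedClassRat (fun M _ _ _ => hochsterTheta R M N) hadd
    (hochsterTheta_self hdim N)

end ThetaHom

theorem mainTheorem7 (R : Type u) [CommRing R] [IsLocalRing R] [IsNoetherianRing R]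
    (hR : IsHypersurface R) (hsing : HasIsolatedSingularity R) (hdim : ringKrullDim R = 1) :
    (∀ (M N : Type u) [AddCommGroup M] [Module R M] [Module.Finite R M]
        [AddCommGroup N] [Module R N] [Module.Finite R N], HochsterThetaDefined R M N) ∧
    ∀ (M : Type u) [AddCommGroup M] [Module R M] [Module.Finite R M],
      ((∀ (N : Type u) [AddCommGroup N] [Module R N] [Module.Finite R N],
          hochsterTheta R M N = 0) ↔ HasConstantRank R M) ∧
      (HasConstantRank R M ↔ reducedClassRat R M = 0) := by
  classical
  obtain ⟨x, hxm, hx, hprinc, hper⟩ := hR.exists_isSMulRegular hdim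
  have hfld := hsing.isField hdim
  have hfin := torLength_ne_top_of_isField hfld
  -- Torsion-free modules are periodic from Tor_2 on; passing to a first syzygy costs one degree, so
  -- arbitrary finite modules are periodic from Tor_3 on.
  have hper' := torLength_add_two_of_forall_isSMulRegular hx (n₀ := 1) hper
  have hAss := mem_associatedPrimes_iff hxm hx hprinc hfld
  refine ⟨fun M N _ _ _ _ _ _ => hochsterThetaDefined_of_periodic hdim (fun n => hfin M n N)
    (hper' M N), fun M _ _ _ => ?_⟩
  have hPfin : {p : PrimeSpectrum R | p.asIdeal ≠ IsLocalRing.maximalIdeal R}.Finite :=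
    Set.Finite.of_injOn (f := PrimeSpectrum.asIdeal) (fun p hp => (hAss p.asIdeal).2 hp)
      (fun _ _ _ _ h => PrimeSpectrum.ext h) (associatedPrimes.finite R R)
  let P := hPfin.toFinset
  have hP : ∀ p, p ∈ P ↔ p.asIdeal ≠ IsLocalRing.maximalIdeal R := fun p => hPfin.mem_toFinset
  have hclass := reducedClassRat_eq_sum hfld hxm hx hP
  have hrank : HasConstantRank R M ↔ ∃ r, ∀ p ∈ P, localRank p.asIdeal M = r := by
    refine exists_congr fun r => ⟨fun h p hp => ?_, fun h p hpp hp => ?_⟩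
    · rw [hP] at hp
      exact (nonempty_equiv_iff_localRank_eq _ (hfld _ hp) M r).1 (h _ ((hAss _).2 hp))
    · have hp' := (hAss p).1 hp
      exact (nonempty_equiv_iff_localRank_eq p (hfld p hp') M r).2 (h ⟨p, hpp⟩ ((hP _).2 hp'))
  have hΘ (N : Type u) [AddCommGroup N] [Module R N] [Module.Finite R N] :=
    exists_hom_hochsterTheta hdim (N := N) (fun M _ _ _ n => hfin M n N) fun M _ _ => hper' M N
  have h23 : HasConstantRank R M → reducedClassRat R M = 0 := by
    rw [hrank]
    rintro ⟨r, hr⟩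
    have h1 := hclass R
    simp only [reducedClassRat_self, localRank_self, one_smul] at h1
    calc reducedClassRat R M = ∑ p ∈ P, r • reducedClassRat R (R ⧸ p.asIdeal) :=
          (hclass M).trans (Finset.sum_congr rfl fun p hp => by rw [hr p hp])
      _ = 0 := by rw [← Finset.smul_sum, ← h1, smul_zero]
  have h31 : reducedClassRat R M = 0 → ∀ (N : Type u) [AddCommGroup N] [Module R N]
      [Module.Finite R N], hochsterTheta R M N = 0 := by
    intro h N _ _ _
    obtain ⟨Φ, hΦ⟩ := hΘ N
    have := hΦ M
    rw [h, map_zero] at this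
    exact_mod_cast this.symm
  have h12 : (∀ (N : Type u) [AddCommGroup N] [Module R N]
      [Module.Finite R N], hochsterTheta R M N = 0) → HasConstantRank R M := by
    intro h
    rw [hrank]
    have hsum (M N : Type u) [AddCommGroup M] [Module R M] [Module.Finite R M]
        [AddCommGroup N] [Module R N] [Module.Finite R N] : (hochsterTheta R M N : ℚ) =
        ∑ p ∈ P, (localRank p.asIdeal M : ℚ) * (hochsterTheta R (R ⧸ p.asIdeal) N : ℚ) := by
      obtain ⟨Φ, hΦ⟩ := hΘ N
      rw [← hΦ M, hclass M, map_sum]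
      refine Finset.sum_congr rfl fun p _ => ?_
      rw [map_nsmul, hΦ, nsmul_eq_mul]
    refine exists_forall_eq_of_sum_mul_eq_zero
      (θ := fun p q => (hochsterTheta R (R ⧸ p.asIdeal) (R ⧸ q.asIdeal) : ℚ)) ?_ ?_ ?_
    -- Off-diagonal positivity: the generator a of q avoids p, since non-maximal primes are pairwise
    -- incomparable.
    · intro p hp q hq hpq
      rw [hP] at hp hq
      obtain ⟨a, b, ha, hba, hb, hab⟩ := exists_mutual_annihilators hx hprinc q.asIdeal (hfld _ hq)
      have hne : a ∉ p.asIdeal := fun hap => hpq (PrimeSpectrum.ext (eq_of_le_of_isField q.2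
        (hfld _ hp) (ha ▸ (Ideal.span_singleton_le_iff_mem _).2 hap)).symm)
      have ham : a ∈ IsLocalRing.maximalIdeal R :=
        IsLocalRing.le_maximalIdeal q.2.ne_top (ha ▸ Ideal.mem_span_singleton_self a)
      rw [Int.cast_pos, hochsterTheta_eq hdim, ha]
      exact hochsterThetaAt_two_pos p.2 hba hb hab hne ham (hfin _ 5 _)
    -- The module R has rank one at every p and θ(R, -) = 0, so expanding θ(R, R/q) gives the zero
    -- column sum.
    · intro q _
      have := hsum R (R ⧸ q.asIdeal)
      rw [hochsterTheta_self hdim, Int.cast_zero] at this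
      rw [this]
      exact Finset.sum_congr rfl fun p _ => by rw [localRank_self, Nat.cast_one, one_mul]
    · intro q _
      rw [← hsum M (R ⧸ q.asIdeal), h, Int.cast_zero]
  exact ⟨⟨h12, fun h => h31 (h23 h)⟩, ⟨h23, fun h => h12 (h31 h)⟩⟩
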